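/- **Setting.** For each $n$ let $X_{n,1},\dots,X_{n,n}$ be independent real random variables (a triangular array). Assume $X_{n,i}$ has a law that is absolutely continuous with respect to Lebesgue measure, with mean $\mu_{n,i}$ and finite variance $\sigma_{n,i}^2$, $\sigma_{n,i}>0$. Write $X_i,\mu_i,\sigma_i$ for short, and put $$U_n^{\rm Ken}=\frac{1}{n(n-1)}\sum_{i\ne j}\mathbf 1(j<i)\,\mathbf 1(X_j>X_i),\qquad U_n^{\rm AP}=\frac{1}{n(n-1)}\sum_{i\ne j}\frac{n\,\mathbf 1(j<i)}{i-1}\,\mathbf 1(X_j>X_i)$$ (with $0/0:=0$), $$R_n=\max_{1\le i\ne j\le n}\Big|\frac{\mu_i-\mu_j}{\sigma_i}\Big|,\qquad \rho_n=\max_{1\le i\ne j\le n}\frac{\sigma_i}{\sigma_j},$$ $$F_j^c(t)=P\Big(\frac{X_j-\mu_j}{\sigma_j}>t\Big),\qquad F_{ji}^c(t)=P\Big\{\frac{X_j-X_i-(\mu_j-\mu_i)}{(\sigma_i^2+\sigma_j^2)^{1/2}}>t\Big\}.$$ A statistic $U_n$ is *asymptotically normal* if ${\rm Var}(U_n)^{-1/2}\{U_n-E(U_n)\}\to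 N(0,1)$ in distribution. For real sequences, $a_n\lesssim b_n$ means that for some constant $C$, $|a_n|\le C|b_n|$ for all large $n$; $a_n\lnsim b_n$ means that $a_n\lesssim b_n$ holds and $b_n\lesssim a_n$ does not. **Theorem.** (i) Assume there are constants $c_1,c_2>0$, $b_1>b_2>0$, $t_0>0$ such that for all $n$, all $1\le i\ne j\le n$ and all $t\ge t_0$, $$c_1t^{-b_1}\le F_j^c(t)\le c_2t^{-b_2},\qquad c_1t^{-b_1}\le F_{ji}^c(t)\le c_2t^{-b_2}.$$ If $$R_n^{(3b_1b_2+b_1^2)/b_2}\rho_n^{b_1}\lnsim n^{1/3}\quad\text{and}\quad \rho_n^{b_1}\lesssim n^{1/3},$$ then $U_n^{\rm Ken}$ is asymptotically normal. If $$R_n^{(3b_1b_2+b_1^2)/b_2}\rho_n^{b_1}\lnsim n^{1/3}(\log n)^{-2}\quad\text{and}\quad \rho_n^{b_1}\lesssim n^{1/3}(\log n)^{-2},$$ then $U_n^{\rm AP}$ is asymptotically normal. (When $R_n$ is bounded away from $0$, the second condition in each pair follows from the first.) (ii) Assume there are constants $\lambda>0$, $c_1,c_2>0$ with $c_1\le 2c_2$,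 $b_1>b_2>0$, $t_0>0$ such that for all $n$, all $1\le i\ne j\le n$ and all $t\ge t_0$, $$c_1e^{-b_1t^\lambda}\le F_j^c(t)\le c_2e^{-b_2t^\lambda},\qquad c_1e^{-b_1t^\lambda}\le F_{ji}^c(t)\le c_2e^{-b_2t^\lambda}.$$ Let $\xi(p)=1$ for $p\le 1$, $\xi(p)=2^{p-1}$ for $p>1$, and $$K_3=t_0+\Big(-\frac1{b_2}\log\frac{c_1}{2c_2}+\frac{b_1}{b_2}t_0^\lambda\Big)^{1/\lambda}+\xi(\lambda^{-1})\Big(-\frac1{b_2}\log\frac{c_1}{2c_2}\Big)^{1/\lambda},\qquad K_4=\xi(\lambda^{-1})\Big(\frac{b_1}{b_2}\Big)^{1/\lambda},$$ $$L_n=3b_1R_n^\lambda+b_1(R_n+K_3\rho_n+K_4\rho_nR_n)^\lambda.$$ If $\exp(L_n)\lnsim \exp\big(\tfrac13\log n\big)=n^{1/3}$, then $U_n^{\rm Ken}$ is asymptotically normal. If $\exp(L_n)\lnsim \exp\big(\tfrac13\log n-2\log\log n\big)=n^{1/3}(\log n)^{-2}$, then $U_n^{\rm AP}$ is asymptotically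 normal. -/

import Mathlib

open MeasureTheory ProbabilityTheory Filter Topology Asymptotics

noncomputable section

namespace RankCLT

/-- `a ≲ b` up to an absolute constant, for all large `n`, while `b ≲ a` fails. -/
def StrictlyLesssim (a b : ℕ → ℝ) : Prop :=
  a =O[atTop] b ∧ ¬ b =O[atTop] a

/-- Transformed Kendall's tau of `x 0, …, x (n-1)`:
`1 / (n (n - 1)) * ∑_{i ≠ j} 1(j < i) 1(x j > x i)`. -/
def kendall {n : ℕ} (x : Fin n → ℝ) : ℝ :=
  1 / ((n : ℝ) * ((n : ℝ) - 1)) *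
    ∑ i : Fin n, ∑ j : Fin n, if j < i ∧ x i < x j then (1 : ℝ) else 0

/-- Transformed average-precision correlation of `x 0, …, x (n-1)`. The weight of a pair `j < i` is
`n` divided by the number of indices below `i`, which is `(i : ℕ)` as `Fin n` starts at `0`. -/
def avgPrecision {n : ℕ} (x : Fin n → ℝ) : ℝ :=
  1 / ((n : ℝ) * ((n : ℝ) - 1)) *
    ∑ i : Fin n, ∑ j : Fin n, if j < i ∧ x i < x j then (n : ℝ) / ((i : ℕ) : ℝ) else 0

/-- `Var(U_n)^{-1/2} (U_n - E U_n)` converges in distribution to `N(0, 1)`. -/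
def AsymptoticallyNormal {Ω : ℕ → Type*} [∀ n, MeasurableSpace (Ω n)]
    (P : ∀ n, Measure (Ω n)) [∀ n, IsProbabilityMeasure (P n)] (U : ∀ n, Ω n → ℝ) : Prop :=
  TendstoInDistribution
    (fun n ω => (√(Var[U n; P n]))⁻¹ * (U n ω - ∫ ω', U n ω' ∂(P n)))
    atTop (fun x : ℝ => x) P (gaussianReal 0 1)

/-- One row of the location-scale model: independent real random variables `X i` with absolutely
continuous laws, means `μ i` and variances `(σ i)²`, `σ i > 0`. -/
structure LocationScale {n : ℕ} {Ω : Type*} [MeasurableSpace Ω] (P : Measure Ω)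
    (X : Fin n → Ω → ℝ) (μ σ : Fin n → ℝ) : Prop where
  measurable : ∀ i, Measurable (X i)
  indep : iIndepFun X P
  absCont : ∀ i, P.map (X i) ≪ volume
  memLp : ∀ i, MemLp (X i) 2 P
  mean : ∀ i, ∫ ω, X i ω ∂P = μ i
  sigma_pos : ∀ i, 0 < σ i
  variance : ∀ i, Var[X i; P] = σ i ^ 2

/-- `R = max_{i ≠ j} |(μ i - μ j) / σ i|` (a maximum as soon as `2 ≤ n`). -/
def spread {n : ℕ} (μ σ : Fin n → ℝ) : ℝ :=
  ⨆ p : {p : Fin n × Fin n // p.1 ≠ p.2}, |(μ p.1.1 - μ p.1.2) / σ p.1.1|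

/-- `ρ = max_{i ≠ j} σ i / σ j` (a maximum as soon as `2 ≤ n`). -/
def scaleRatio {n : ℕ} (σ : Fin n → ℝ) : ℝ :=
  ⨆ p : {p : Fin n × Fin n // p.1 ≠ p.2}, σ p.1.1 / σ p.1.2

/-- `P((X j - μ j) / σ j > t)`. -/
def survival {n : ℕ} {Ω : Type*} [MeasurableSpace Ω] (P : Measure Ω)
    (X : Fin n → Ω → ℝ) (μ σ : Fin n → ℝ) (j : Fin n) (t : ℝ) : ℝ :=
  P.real {ω | t < (X j ω - μ j) / σ j}

/-- `P((X j - X i - (μ j - μ i)) / (σ i² + σ j²)^{1/2} > t)`. -/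
def survivalDiff {n : ℕ} {Ω : Type*} [MeasurableSpace Ω] (P : Measure Ω)
    (X : Fin n → Ω → ℝ) (μ σ : Fin n → ℝ) (j i : Fin n) (t : ℝ) : ℝ :=
  P.real {ω | t < (X j ω - X i ω - (μ j - μ i)) / √(σ i ^ 2 + σ j ^ 2)}

/-- For all `n`, all `i ≠ j` and all `t ≥ t₀`, both standardized survival functions lie between
`lo t` and `up t`. -/
def TailBounds {Ω : ℕ → Type*} [∀ n, MeasurableSpace (Ω n)] (P : ∀ n, Measure (Ω n))
    (X : ∀ n, Fin n → Ω n → ℝ) (μ σ : ∀ n, Fin n → ℝ) (t₀ : ℝ) (lo up : ℝ → ℝ) : Prop :=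
  ∀ n, ∀ i j : Fin n, i ≠ j → ∀ t, t₀ ≤ t →
    (lo t ≤ survival (P n) (X n) (μ n) (σ n) j t ∧
      survival (P n) (X n) (μ n) (σ n) j t ≤ up t) ∧
    (lo t ≤ survivalDiff (P n) (X n) (μ n) (σ n) j i t ∧
      survivalDiff (P n) (X n) (μ n) (σ n) j i t ≤ up t)

/-- `ξ(p) = 1` for `p ≤ 1` and `ξ(p) = 2^{p-1}` for `p > 1`. -/
def xi (p : ℝ) : ℝ := if p ≤ 1 then 1 else (2 : ℝ) ^ (p - 1)

def K₃ (c₁ c₂ b₁ b₂ t₀ l : ℝ) : ℝ :=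
  t₀ + (-(1 / b₂) * Real.log (c₁ / (2 * c₂)) + b₁ / b₂ * t₀ ^ l) ^ (1 / l)
    + xi (1 / l) * (-(1 / b₂) * Real.log (c₁ / (2 * c₂))) ^ (1 / l)

def K₄ (b₁ b₂ l : ℝ) : ℝ := xi (1 / l) * (b₁ / b₂) ^ (1 / l)

/-- `R^{(3 b₁ b₂ + b₁²) / b₂} ρ^{b₁}`. -/
def heavyRate (b₁ b₂ R ρ : ℝ) : ℝ := R ^ ((3 * b₁ * b₂ + b₁ ^ 2) / b₂) * ρ ^ b₁

/-- `3 b₁ R^l + b₁ (R + K₃ ρ + K₄ ρ R)^l`. -/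
def lightRate (c₁ c₂ b₁ b₂ t₀ l R ρ : ℝ) : ℝ :=
  3 * b₁ * R ^ l + b₁ * (R + K₃ c₁ c₂ b₁ b₂ t₀ l * ρ + K₄ b₁ b₂ l * ρ * R) ^ l

end RankCLT

end

/-!
Both statistics are multiples of `∑_{j < i} w i 1(x i < x j)` with weights `1 ≤ w i ≤ n / i`. This
sum is compared with its Hájek projection, the sum over `k` of a function of `x k` alone: the
residuals of distinct pairs `j < i` are uncorrelated, so the remainder has variance
`O(∑_i i (w i)²)`, that is `O(n² log n)`. The summands of the projection are `O(n log n)`, hence the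
projection, and with it the statistic, is asymptotically normal as soon as the variance of the
projection dominates `(n log n)²`.

The difficulty is to bound this variance from below, because the `k`-th summand is the difference of
two monotone functions: the pairs in which `k` is the larger index contribute a decreasing one, the
others an increasing one. For `k` close to `n` the latter varies by at most `2 (n - k)`. With `R`,
`ρ` as in the theorem, `r` of the order of the lower tail bound at `R`, and `M` so large that the
upper tail bound at `M` is at most `r`, the decreasing part drops by at least `k r` between `μ k`
and `μ k + (R + M ρ) σ k`. So for each of the last `n r / 8` indices the variance is of order
`(n r)²` times the lower tail bound at `R + M ρ`.
-/

noncomputable section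

namespace RankCLT

section Standardized

variable {Ω : Type*} [MeasurableSpace Ω] {P : Measure Ω} {U H : Ω → ℝ}

/-- The standardization of a random variable, as in `AsymptoticallyNormal`. It is identically `0`
when the variance vanishes. -/
def standardized (P : Measure Ω) (U : Ω → ℝ) (ω : Ω) : ℝ :=
  (√Var[U; P])⁻¹ * (U ω - ∫ ω', U ω' ∂P)

lemma aemeasurable_standardized (hU : AEMeasurable U P) : AEMeasurable (standardized P U) P :=
  (hU.sub_const _).const_mul _

lemma standardized_const_mul {d : ℝ} (hd : 0 < d) (U : Ω → ℝ) :
    standardized P (fun ω => d * U ω) = standardized P U := by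
  funext ω
  simp only [standardized, variance_const_mul, integral_const_mul, Real.sqrt_mul (sq_nonneg d),
    Real.sqrt_sq hd.le]
  field_simp

variable [IsProbabilityMeasure P]

lemma memLp_standardized (hU : MemLp U 2 P) : MemLp (standardized P U) 2 P :=
  (hU.sub (memLp_const _)).const_mul _

lemma integral_standardized (hU : Integrable U P) : ∫ ω, standardized P U ω ∂P = 0 := by
  simp only [standardized, integral_const_mul, integral_sub hU (integrable_const _), integral_const,
    probReal_univ, one_smul, sub_self, mul_zero]

lemma covariance_standardized (hU : Integrable U P) (hH : Integrable H P) :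
    cov[standardized P U, standardized P H; P]
      = (√Var[U; P])⁻¹ * (√Var[H; P])⁻¹ * cov[U, H; P] := by
  unfold standardized
  rw [covariance_const_mul_left, covariance_const_mul_right,
    covariance_sub_const_left hU, covariance_sub_const_right hH]
  ring

lemma variance_standardized (hU : AEStronglyMeasurable U P) :
    Var[standardized P U; P] = (√Var[U; P])⁻¹ ^ 2 * Var[U; P] := by
  unfold standardized
  rw [variance_const_mul, variance_sub_const hU]

lemma sq_covariance_le (hU : MemLp U 2 P) (hH : MemLp H 2 P) :
    cov[U, H; P] ^ 2 ≤ Var[U; P] * Var[H; P] := by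
  have nonneg_quadratic : ∀ x : ℝ,
      0 ≤ Var[U; P] * (x * x) + 2 * cov[U, H; P] * x + Var[H; P] := fun x => by
    have h := variance_nonneg (fun ω => x * U ω + H ω) P
    rw [variance_fun_add (hU.const_mul x) hH, variance_const_mul, covariance_const_mul_left] at h
    linarith
  have := discrim_le_zero nonneg_quadratic
  rw [discrim] at this
  linarith

lemma two_sub_two_mul_le_of_abs_le_one {r u v : ℝ} (hr : |r| ≤ 1) (hu : 0 ≤ u) (hv : 0 < v) :
    2 - 2 * r ≤ 4 * (u ^ 2 - 2 * (u * v * r) + v ^ 2) / v ^ 2 := by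
  obtain ⟨hr₁, hr₂⟩ := abs_le.1 hr
  rw [le_div_iff₀ (by positivity), ← sub_nonneg]
  calc 0 ≤ 2 * (1 + r) * (u - v) ^ 2 + 2 * (1 - r) * (u * (u + 2 * v)) := by
        have : 0 ≤ 1 + r := by linarith
        have : 0 ≤ 1 - r := by linarith
        positivity
    _ = 4 * (u ^ 2 - 2 * (u * v * r) + v ^ 2) - (2 - 2 * r) * v ^ 2 := by ring

lemma variance_standardized_sub_le (hU : MemLp U 2 P) (hH : MemLp H 2 P) (hpos : 0 < Var[H; P]) :
    Var[standardized P U - standardized P H; P]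
      ≤ 4 * Var[U - H; P] / Var[H; P] := by
  rw [variance_sub (memLp_standardized hU) (memLp_standardized hH), variance_sub hU hH,
    variance_standardized hU.1, variance_standardized hH.1,
    covariance_standardized (hU.integrable one_le_two) (hH.integrable one_le_two)]
  have cauchy_schwarz := sq_covariance_le hU hH
  have hu : 0 ≤ √Var[U; P] := Real.sqrt_nonneg _
  have hv : 0 < √Var[H; P] := Real.sqrt_pos.2 hpos
  rw [← Real.sq_sqrt (variance_nonneg U P), ← Real.sq_sqrt hpos.le] at cauchy_schwarz ⊢
  rw [Real.sqrt_sq hu, Real.sqrt_sq hv.le]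
  set u := √Var[U; P]
  set v := √Var[H; P]
  set c := cov[U, H; P]
  have abs_corr_le : |u⁻¹ * v⁻¹ * c| ≤ 1 := by
    rw [← sq_le_one_iff_abs_le_one, ← mul_inv, inv_mul_eq_div, div_pow, mul_pow]
    exact div_le_one_of_le₀ cauchy_schwarz (by positivity)
  have cov_eq : c = u * v * (u⁻¹ * v⁻¹ * c) := by
    obtain hu₀ | hu₀ := hu.eq_or_lt
    · rw [← hu₀, zero_pow two_ne_zero, zero_mul] at cauchy_schwarz
      rw [pow_eq_zero_iff two_ne_zero |>.1 (cauchy_schwarz.antisymm (sq_nonneg c)), mul_zero,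
        mul_zero]
    · field_simp
  have hu₁ : u⁻¹ ^ 2 * u ^ 2 ≤ 1 := by
    rw [← mul_pow]
    exact pow_le_one₀ (by positivity) inv_mul_le_one
  have hv₁ : v⁻¹ ^ 2 * v ^ 2 = 1 := by rw [← mul_pow, inv_mul_cancel₀ hv.ne', one_pow]
  calc _ ≤ 2 - 2 * (u⁻¹ * v⁻¹ * c) := by linarith
    _ ≤ 4 * (u ^ 2 - 2 * (u * v * (u⁻¹ * v⁻¹ * c)) + v ^ 2) / v ^ 2 :=
        two_sub_two_mul_le_of_abs_le_one abs_corr_le hu hv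
    _ = 4 * (u ^ 2 - 2 * c + v ^ 2) / v ^ 2 := by rw [← cov_eq]

end Standardized

section CharFun

variable {Ω : Type*} [MeasurableSpace Ω] {P : Measure Ω} {f g : Ω → ℝ}

lemma charFun_map_real (hf : AEMeasurable f P) (t : ℝ) :
    charFun (P.map f) t = ∫ ω, Complex.exp ((t * f ω : ℝ) * Complex.I) ∂P := by
  rw [charFun_apply_real, integral_map hf (by fun_prop)]
  simp only [Complex.ofReal_mul]

lemma integrable_exp_mul_I [IsFiniteMeasure P] (hf : AEMeasurable f P) :
    Integrable (fun ω => Complex.exp (f ω * Complex.I)) P :=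
  .of_bound (by fun_prop) 1 (ae_of_all _ fun ω => (Complex.norm_exp_ofReal_mul_I _).le)

lemma norm_exp_mul_I_sub_exp_mul_I_le (a b : ℝ) :
    ‖Complex.exp (a * Complex.I) - Complex.exp (b * Complex.I)‖ ≤ |a - b| := by
  have factor : Complex.exp (a * Complex.I) - Complex.exp (b * Complex.I)
      = Complex.exp (b * Complex.I) * (Complex.exp (Complex.I * ((a - b : ℝ) : ℂ)) - 1) := by
    rw [mul_sub, ← Complex.exp_add, mul_one]
    push_cast
    ring_nf
  rw [factor, norm_mul, Complex.norm_exp_ofReal_mul_I, one_mul]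
  exact Real.norm_exp_I_mul_ofReal_sub_one_le

lemma norm_charFun_map_sub_le [IsFiniteMeasure P] (hf : Integrable f P) (hg : Integrable g P)
    (t : ℝ) :
    ‖charFun (P.map f) t - charFun (P.map g) t‖ ≤ |t| * ∫ ω, |f ω - g ω| ∂P := by
  have hf' := hf.aemeasurable
  have hg' := hg.aemeasurable
  rw [charFun_map_real hf', charFun_map_real hg',
    ← integral_sub (integrable_exp_mul_I (hf'.const_mul t))
      (integrable_exp_mul_I (hg'.const_mul t)), ← integral_const_mul]
  refine norm_integral_le_of_norm_le ((hf.sub hg).abs.const_mul _) (ae_of_all _ fun ω => ?_)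
  refine (norm_exp_mul_I_sub_exp_mul_I_le _ _).trans_eq ?_
  rw [← mul_sub, abs_mul]

variable [IsProbabilityMeasure P]

lemma integral_abs_le_sqrt_integral_sq (hf : MemLp f 2 P) :
    ∫ ω, |f ω| ∂P ≤ √(∫ ω, f ω ^ 2 ∂P) := by
  have h := variance_nonneg |f| P
  rw [variance_eq_sub hf.abs] at h
  simp only [Pi.pow_apply, Pi.abs_apply, sq_abs] at h
  exact Real.le_sqrt_of_sq_le (by linarith)

lemma norm_charFun_standardized_sub_le {U H : Ω → ℝ} (hU : MemLp U 2 P) (hH : MemLp H 2 P)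
    (hpos : 0 < Var[H; P]) (t : ℝ) :
    ‖charFun (P.map (standardized P U)) t - charFun (P.map (standardized P H)) t‖
      ≤ |t| * √(4 * (Var[U - H; P] / Var[H; P])) := by
  have hU' := memLp_standardized hU
  have hH' := memLp_standardized hH
  have int_diff : ∫ ω, (standardized P U - standardized P H) ω ∂P = 0 := by
    rw [integral_sub' (hU'.integrable one_le_two) (hH'.integrable one_le_two),
      integral_standardized (hU.integrable one_le_two),
      integral_standardized (hH.integrable one_le_two), sub_zero]
  refine (norm_charFun_map_sub_le (hU'.integrable one_le_two) (hH'.integrable one_le_two)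
    t).trans ?_
  gcongr
  refine (integral_abs_le_sqrt_integral_sq (hU'.sub hH')).trans (Real.sqrt_le_sqrt ?_)
  have := variance_standardized_sub_le hU hH hpos
  rwa [variance_of_integral_eq_zero (hU'.sub hH').aemeasurable int_diff, mul_div_assoc] at this

end CharFun

section CentralLimit

lemma norm_prod_sub_prod_le {ι R : Type*} [NormedCommRing R] [NormOneClass R] {s : Finset ι}
    {a b : ι → R} (ha : ∀ i ∈ s, ‖a i‖ ≤ 1) (hb : ∀ i ∈ s, ‖b i‖ ≤ 1) :
    ‖∏ i ∈ s, a i - ∏ i ∈ s, b i‖ ≤ ∑ i ∈ s, ‖a i - b i‖ := by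
  classical
  induction s using Finset.induction_on with
  | empty => simp
  | insert i s hi ih =>
    rw [Finset.forall_mem_insert] at ha hb
    rw [Finset.prod_insert hi, Finset.prod_insert hi, Finset.sum_insert hi]
    have norm_prod_le_one : ‖∏ j ∈ s, a j‖ ≤ 1 :=
      (s.norm_prod_le a).trans (Finset.prod_le_one (fun _ _ => norm_nonneg _) ha.2)
    calc ‖a i * ∏ j ∈ s, a j - b i * ∏ j ∈ s, b j‖
        = ‖(a i - b i) * ∏ j ∈ s, a j + b i * (∏ j ∈ s, a j - ∏ j ∈ s, b j)‖ := by ring_nf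
      _ ≤ ‖a i - b i‖ * ‖∏ j ∈ s, a j‖ + ‖b i‖ * ‖∏ j ∈ s, a j - ∏ j ∈ s, b j‖ :=
          (norm_add_le _ _).trans (add_le_add (norm_mul_le _ _) (norm_mul_le _ _))
      _ ≤ ‖a i - b i‖ * 1 + 1 * ∑ j ∈ s, ‖a j - b j‖ := by
          gcongr
          exacts [hb.1, ih ha.2 hb.2]
      _ = ‖a i - b i‖ + ∑ j ∈ s, ‖a j - b j‖ := by ring

lemma norm_exp_mul_I_sub_taylor_two_le {u : ℝ} (hu : |u| ≤ 1) :
    ‖Complex.exp (u * Complex.I) - (1 + u * Complex.I - (u ^ 2 / 2 : ℝ))‖ ≤ 3 * |u| ^ 3 := by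
  have h := Complex.norm_exp_sub_sum_le_norm_mul_exp (u * Complex.I) 3
  have taylor_sum : ∑ m ∈ Finset.range 3, ((u : ℂ) * Complex.I) ^ m / (m.factorial : ℂ)
      = 1 + u * Complex.I - (u ^ 2 / 2 : ℝ) := by
    simp only [Finset.sum_range_succ, Finset.sum_range_zero, Nat.factorial, mul_pow, Complex.I_sq]
    push_cast
    ring
  have norm_eq : ‖(u : ℂ) * Complex.I‖ = |u| := by simp
  rw [norm_eq, taylor_sum] at h
  have exp_le_three : Real.exp |u| ≤ 3 :=
    (Real.exp_le_exp.2 hu).trans (by linarith [Real.exp_one_lt_d9])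
  calc _ ≤ |u| ^ 3 * Real.exp |u| := h
    _ ≤ |u| ^ 3 * 3 := by gcongr
    _ = 3 * |u| ^ 3 := mul_comm _ _

lemma charFun_gaussianReal_zero_toNNReal {v : ℝ} (hv : 0 ≤ v) (t : ℝ) :
    charFun (gaussianReal 0 v.toNNReal) t = (Real.exp (-(t ^ 2 * v / 2)) : ℝ) := by
  rw [charFun_gaussianReal]
  push_cast [Real.coe_toNNReal v hv]
  ring_nf

variable {Ω : Type*} [MeasurableSpace Ω] {P : Measure Ω}

lemma standardized_sum {ι : Type*} [Fintype ι] {Y : ι → Ω → ℝ} (hY : ∀ k, Integrable (Y k) P) :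
    standardized P (∑ k, Y k)
      = fun ω => (√Var[∑ k, Y k; P])⁻¹ * ∑ k, (Y k ω - ∫ ω', Y k ω' ∂P) := by
  funext ω
  simp only [standardized, Finset.sum_apply, integral_finsetSum _ fun k _ => hY k,
    Finset.sum_sub_distrib]

lemma charFun_standardized_sum {ι : Type*} [Fintype ι] {Y : ι → Ω → ℝ} (hindep : iIndepFun Y P)
    (hY : ∀ k, Integrable (Y k) P) (t : ℝ) :
    charFun (P.map (standardized P (∑ k, Y k))) t
      = ∏ k, charFun (P.map fun ω => Y k ω - ∫ ω', Y k ω' ∂P) ((√Var[∑ k, Y k; P])⁻¹ * t) := by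
  have hm : ∀ k, AEMeasurable (fun ω => Y k ω - ∫ ω', Y k ω' ∂P) P := fun k =>
    (hY k).aemeasurable.sub_const _
  have hindep' : iIndepFun (fun k ω => Y k ω - ∫ ω', Y k ω' ∂P) P :=
    hindep.comp (fun k y => y - ∫ ω', Y k ω' ∂P) fun k => measurable_id.sub_const _
  rw [standardized_sum hY, charFun_map_mul_comp (Finset.aemeasurable_fun_sum _ fun k _ => hm k),
    hindep'.charFun_map_fun_sum_eq_prod hm, Finset.prod_apply]

variable [IsProbabilityMeasure P]

lemma norm_charFun_map_sub_one_sub_sq_le {g : Ω → ℝ} (hg : MemLp g 2 P) {ε t : ℝ}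
    (hbound : ∀ᵐ ω ∂P, |g ω| ≤ ε) (hcentred : ∫ ω, g ω ∂P = 0) (ht : |t| * ε ≤ 1) :
    ‖charFun (P.map g) t - (1 - t ^ 2 * Var[g; P] / 2 : ℝ)‖ ≤ 3 * |t| ^ 3 * ε * Var[g; P] := by
  have hgm := hg.aemeasurable
  have int_lin : Integrable (fun ω => 1 + ((t * g ω : ℝ) : ℂ) * Complex.I) P :=
    (integrable_const 1).add (((hg.integrable one_le_two).const_mul t).ofReal.mul_const _)
  have int_sq : Integrable (fun ω => (((t * g ω) ^ 2 / 2 : ℝ) : ℂ)) P :=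
    ((hg.const_mul t).integrable_sq.div_const 2).ofReal
  have taylor_integral :
      ∫ ω, (1 + ((t * g ω : ℝ) : ℂ) * Complex.I - (((t * g ω) ^ 2 / 2 : ℝ) : ℂ)) ∂P
        = (1 - t ^ 2 * Var[g; P] / 2 : ℝ) := by
    rw [integral_sub int_lin int_sq, integral_add (integrable_const _)
      (((hg.integrable one_le_two).const_mul t).ofReal.mul_const _), integral_mul_const,
      integral_complex_ofReal, integral_complex_ofReal, integral_const_mul, hcentred, integral_div,
      variance_of_integral_eq_zero hgm hcentred]
    simp only [mul_pow, integral_const_mul]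
    simp
  rw [charFun_map_real hgm, ← taylor_integral,
    ← integral_sub (integrable_exp_mul_I (hgm.const_mul t)) (by exact int_lin.sub int_sq),
    variance_of_integral_eq_zero hgm hcentred, ← integral_const_mul]
  refine norm_integral_le_of_norm_le (hg.integrable_sq.const_mul _) ?_
  filter_upwards [hbound] with ω hω
  have small : |t * g ω| ≤ 1 := by
    rw [abs_mul]
    exact (mul_le_mul_of_nonneg_left hω (abs_nonneg t)).trans ht
  calc _ ≤ 3 * |t * g ω| ^ 3 := norm_exp_mul_I_sub_taylor_two_le small
    _ = 3 * |t| ^ 3 * |g ω| * g ω ^ 2 := by rw [abs_mul, ← sq_abs (g ω)]; ring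
    _ ≤ 3 * |t| ^ 3 * ε * g ω ^ 2 := by gcongr

lemma norm_charFun_map_sub_gaussian_le {g : Ω → ℝ} (hg : MemLp g 2 P) {ε t : ℝ}
    (hbound : ∀ᵐ ω ∂P, |g ω| ≤ ε) (hcentred : ∫ ω, g ω ∂P = 0) (ht : |t| * ε ≤ 1) :
    ‖charFun (P.map g) t - charFun (gaussianReal 0 Var[g; P].toNNReal) t‖
      ≤ 4 * |t| ^ 3 * ε * Var[g; P] := by
  have hv := variance_nonneg g P
  obtain ⟨ω, hω⟩ := hbound.exists
  have hε : 0 ≤ ε := (abs_nonneg _).trans hω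
  have hvε : Var[g; P] ≤ ε ^ 2 := by
    have := variance_le_sq_of_bounded (a := -ε) (b := ε)
      (hbound.mono fun ω hω => Set.mem_Icc.2 (abs_le.1 hω)) hg.aemeasurable
    linarith [this]
  rw [charFun_gaussianReal_zero_toNNReal hv]
  set q := t ^ 2 * Var[g; P] / 2 with hq
  have hq0 : 0 ≤ q := by positivity
  have hqε : q ≤ (|t| * ε) ^ 2 / 2 := by
    rw [hq, mul_pow, sq_abs]
    gcongr
  have exp_taylor : ‖((1 - q : ℝ) : ℂ) - (Real.exp (-q) : ℝ)‖ ≤ q ^ 2 := by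
    have hq1 : |(-q)| ≤ 1 := by
      rw [abs_neg, abs_of_nonneg hq0]
      nlinarith [mul_nonneg (abs_nonneg t) hε]
    rw [← Complex.ofReal_sub, Complex.norm_real, Real.norm_eq_abs, abs_sub_comm, ← neg_sq]
    convert! Real.abs_exp_sub_one_sub_id_le hq1 using 2
    ring
  have sq_le : q ^ 2 ≤ |t| ^ 3 * ε * Var[g; P] :=
    calc q ^ 2 ≤ q * (2 * (|t| * ε)) := by nlinarith [mul_nonneg (abs_nonneg t) hε]
      _ = |t| ^ 3 * ε * Var[g; P] := by rw [hq, ← sq_abs t]; ring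
  calc _ ≤ _ := norm_sub_le_norm_sub_add_norm_sub _ ((1 - q : ℝ) : ℂ) _
    _ ≤ 3 * |t| ^ 3 * ε * Var[g; P] + |t| ^ 3 * ε * Var[g; P] :=
        add_le_add (norm_charFun_map_sub_one_sub_sq_le hg hbound hcentred ht)
          (exp_taylor.trans sq_le)
    _ = 4 * |t| ^ 3 * ε * Var[g; P] := by ring

lemma norm_charFun_standardized_sum_sub_gaussian_le {ι : Type*} [Fintype ι] {Y : ι → Ω → ℝ}
    (hindep : iIndepFun Y P) (hY : ∀ k, MemLp (Y k) 2 P) {B t : ℝ}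
    (hB : ∀ k, ∀ᵐ ω ∂P, |Y k ω - ∫ ω', Y k ω' ∂P| ≤ B) (hpos : 0 < Var[∑ k, Y k; P])
    (ht : |t| * B ≤ √Var[∑ k, Y k; P]) :
    ‖charFun (P.map (standardized P (∑ k, Y k))) t - charFun (gaussianReal 0 1) t‖
      ≤ 4 * |t| ^ 3 * (B / √Var[∑ k, Y k; P]) := by
  have hvar : ∑ k, Var[Y k; P] = Var[∑ k, Y k; P] :=
    (IndepFun.variance_sum (fun k _ => hY k) fun i _ j _ hij => hindep.indepFun hij).symm
  set s := √Var[∑ k, Y k; P]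
  have hs : 0 < s := Real.sqrt_pos.2 hpos
  have hs2 : ∑ k, Var[Y k; P] = s ^ 2 := hvar.trans (Real.sq_sqrt hpos.le).symm
  have hvk : ∀ k, Var[fun ω => Y k ω - ∫ ω', Y k ω' ∂P; P] = Var[Y k; P] := fun k =>
    variance_sub_const (hY k).1 _
  have gaussian_eq_prod : charFun (gaussianReal 0 1) t
      = ∏ k, charFun (gaussianReal 0 Var[Y k; P].toNNReal) (s⁻¹ * t) := by
    simp only [charFun_gaussianReal_zero_toNNReal (variance_nonneg _ _), ← Complex.ofReal_prod,
      ← Real.exp_sum, Finset.sum_neg_distrib, ← Finset.sum_div, ← Finset.mul_sum, hs2,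
      charFun_gaussianReal]
    rw [mul_pow, inv_pow, inv_mul_eq_div, div_mul_cancel₀ _ (by positivity)]
    push_cast
    ring_nf
  have hY1 : ∀ k, Integrable (Y k) P := fun k => (hY k).integrable one_le_two
  rw [gaussian_eq_prod, charFun_standardized_sum hindep hY1]
  have (k : ι) : IsProbabilityMeasure (P.map fun ω => Y k ω - ∫ ω', Y k ω' ∂P) :=
    Measure.isProbabilityMeasure_map ((hY k).aemeasurable.sub_const _)
  have habs : |s⁻¹ * t| = |t| / s := by
    rw [abs_mul, abs_of_pos (inv_pos.2 hs), inv_mul_eq_div]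
  calc _ ≤ ∑ k, 4 * |s⁻¹ * t| ^ 3 * B * Var[Y k; P] := by
        refine (norm_prod_sub_prod_le (fun _ _ => norm_charFun_le_one _)
          fun _ _ => norm_charFun_le_one _).trans (Finset.sum_le_sum fun k _ => ?_)
        have centred : ∫ ω, (Y k ω - ∫ ω', Y k ω' ∂P) ∂P = 0 := by
          simp [integral_sub (hY1 k) (integrable_const _)]
        rw [← hvk k]
        refine norm_charFun_map_sub_gaussian_le ((hY k).sub (memLp_const _)) (hB k) centred ?_
        rwa [habs, div_mul_eq_mul_div, div_le_one hs]
    _ = 4 * |t| ^ 3 * (B / s) := by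
        rw [← Finset.mul_sum, hs2, habs]
        field_simp

end CentralLimit

section AsymptoticNormality

variable {Ω : ℕ → Type*} [∀ n, MeasurableSpace (Ω n)] {P : ∀ n, Measure (Ω n)}
  [∀ n, IsProbabilityMeasure (P n)] {U : ∀ n, Ω n → ℝ}

lemma asymptoticallyNormal_iff_tendsto_charFun (hU : ∀ n, AEMeasurable (U n) (P n)) :
    AsymptoticallyNormal P U ↔
      ∀ t, Tendsto (fun n => charFun ((P n).map (standardized (P n) (U n))) t) atTop
        (𝓝 (charFun (gaussianReal 0 1) t)) := by
  refine ⟨fun h t => ?_, fun h => ⟨fun n => aemeasurable_standardized (hU n), aemeasurable_id,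
    ProbabilityMeasure.tendsto_iff_tendsto_charFun.2 fun t => ?_⟩⟩
  · have := ProbabilityMeasure.tendsto_iff_tendsto_charFun.1 h.tendsto t
    rwa [ProbabilityMeasure.coe_mk, Measure.map_id'] at this
  · rw [ProbabilityMeasure.coe_mk, Measure.map_id']
    exact h t

lemma AsymptoticallyNormal.const_mul (hU : ∀ n, AEMeasurable (U n) (P n))
    (h : AsymptoticallyNormal P U) {d : ℕ → ℝ} (hd : ∀ᶠ n in atTop, 0 < d n) :
    AsymptoticallyNormal P (fun n ω => d n * U n ω) := by
  rw [asymptoticallyNormal_iff_tendsto_charFun fun n => (hU n).const_mul _]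
  refine fun t => ((asymptoticallyNormal_iff_tendsto_charFun hU).1 h t).congr' ?_
  filter_upwards [hd] with n hn
  rw [standardized_const_mul hn]

lemma asymptoticallyNormal_of_variance_sub_isLittleO {ι : ℕ → Type*} [∀ n, Fintype (ι n)]
    {Y : ∀ n, ι n → Ω n → ℝ} {B : ℕ → ℝ} (hU : ∀ n, MemLp (U n) 2 (P n))
    (hindep : ∀ n, iIndepFun (Y n) (P n)) (hY : ∀ n k, MemLp (Y n k) 2 (P n))
    (hB : ∀ n k, ∀ᵐ ω ∂P n, |Y n k ω - ∫ ω', Y n k ω' ∂P n| ≤ B n)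
    (hpos : ∀ᶠ n in atTop, 0 < Var[∑ k, Y n k; P n])
    (hBV : (fun n => B n ^ 2) =o[atTop] fun n => Var[∑ k, Y n k; P n])
    (hUV : (fun n => Var[U n - ∑ k, Y n k; P n]) =o[atTop] fun n => Var[∑ k, Y n k; P n]) :
    AsymptoticallyNormal P U := by
  refine (asymptoticallyNormal_iff_tendsto_charFun fun n => (hU n).aemeasurable).2 fun t => ?_
  have proj_small : Tendsto (fun n => |t| * √(4 *
      (Var[U n - ∑ k, Y n k; P n] / Var[∑ k, Y n k; P n]))) atTop (𝓝 0) := by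
    have := ((hUV.tendsto_div_nhds_zero.const_mul 4).sqrt).const_mul |t|
    rwa [mul_zero, Real.sqrt_zero, mul_zero] at this
  have bound_small : Tendsto (fun n => B n / √Var[∑ k, Y n k; P n]) atTop (𝓝 0) := by
    refine (tendsto_zero_iff_abs_tendsto_zero _).2 ?_
    have := hBV.tendsto_div_nhds_zero.sqrt
    simpa only [Real.sqrt_div (sq_nonneg _), Real.sqrt_sq_eq_abs, Real.sqrt_zero,
      Function.comp_def, abs_div, abs_of_nonneg (Real.sqrt_nonneg _)] using this
  rw [tendsto_iff_norm_sub_tendsto_zero]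
  refine squeeze_zero' (Eventually.of_forall fun n => norm_nonneg _) ?_
    (by simpa only [mul_zero, add_zero] using
      proj_small.add (bound_small.const_mul (4 * |t| ^ 3)))
  have lindeberg : ∀ᶠ n in atTop, |t| * (B n / √Var[∑ k, Y n k; P n]) < 1 :=
    (bound_small.const_mul |t|).eventually_lt_const (by simp)
  filter_upwards [hpos, lindeberg] with n hn hnt
  rw [← mul_div_assoc, div_lt_one (Real.sqrt_pos.2 hn)] at hnt
  exact (norm_sub_le_norm_sub_add_norm_sub _ _ _).trans (add_le_add
    (norm_charFun_standardized_sub_le (hU n) (memLp_finsetSum' _ fun k _ => hY n k) hn t)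
    (norm_charFun_standardized_sum_sub_gaussian_le (hindep n) (hY n) (hB n) hn hnt.le))

end AsymptoticNormality

section Resampling

variable {ι : Type*} [Fintype ι] [DecidableEq ι] {E : ι → Type*} [∀ i, MeasurableSpace (E i)]
  (ν : ∀ i, Measure (E i)) [∀ i, IsProbabilityMeasure (ν i)]

lemma measurePreserving_update (m : ι) :
    MeasurePreserving (fun p : (∀ i, E i) × E m => Function.update p.1 m p.2)
      ((Measure.pi ν).prod (ν m)) (Measure.pi ν) := by
  refine ⟨measurable_update', (Measure.pi_eq fun s hs => ?_).symm⟩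
  have hpre : (fun p : (∀ i, E i) × E m => Function.update p.1 m p.2) ⁻¹' Set.univ.pi s
      = Set.univ.pi (Function.update s m Set.univ) ×ˢ s m := by
    ext ⟨x, y⟩
    simp only [Set.mem_preimage, Set.mem_univ_pi, Set.mem_prod]
    rw [Function.forall_update_iff x (fun i z => z ∈ s i),
      Function.forall_update_iff s (fun i t => x i ∈ t)]
    simp only [Set.mem_univ, true_and, and_comm]
  rw [Measure.map_apply measurable_update' (MeasurableSet.univ_pi hs), hpre, Measure.prod_prod,
    Measure.pi_pi, ← Finset.prod_erase_mul _ _ (Finset.mem_univ m),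
    ← Finset.prod_erase_mul (a := m) Finset.univ (fun i => ν i (s i)) (Finset.mem_univ m),
    Function.update_self, measure_univ, mul_one]
  congr 1
  exact Finset.prod_congr rfl fun i hi => by rw [Function.update_of_ne (Finset.ne_of_mem_erase hi)]

lemma integral_pi_eq_integral_update (m : ι) {f : (∀ i, E i) → ℝ}
    (hf : Integrable f (Measure.pi ν)) :
    ∫ x, f x ∂Measure.pi ν = ∫ x, ∫ y, f (Function.update x m y) ∂ν m ∂Measure.pi ν := by
  have hm := measurePreserving_update ν m
  rw [← hm.map_eq] at hf
  conv_lhs => rw [← hm.map_eq]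
  rw [integral_map hm.aemeasurable hf.aestronglyMeasurable,
    integral_prod (fun p : (∀ i, E i) × E m => f (Function.update p.1 m p.2))
      (hf.comp_measurable hm.measurable)]

lemma covariance_eq_zero_of_update (m : ι) {u f : (∀ i, E i) → ℝ} {c : ℝ}
    (hu : MemLp u 2 (Measure.pi ν)) (hf : MemLp f 2 (Measure.pi ν))
    (hum : ∀ x y, u (Function.update x m y) = u x)
    (hfm : ∀ x, ∫ y, f (Function.update x m y) ∂ν m = c) :
    cov[u, f; Measure.pi ν] = 0 := by
  have huf : ∫ x, u x * f x ∂Measure.pi ν = (∫ x, u x ∂Measure.pi ν) * c := by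
    rw [integral_pi_eq_integral_update ν m (f := fun x => u x * f x) (hu.integrable_mul hf)]
    simp only [hum, integral_const_mul, hfm, integral_mul_const]
  have hf_mean : ∫ x, f x ∂Measure.pi ν = c := by
    rw [integral_pi_eq_integral_update ν m (hf.integrable one_le_two)]
    simp only [hfm, integral_const, probReal_univ, one_smul]
  rw [covariance_eq_sub hu hf, hf_mean, ← huf]
  exact sub_self _

end Resampling

section HoeffdingDecomposition

lemma measurable_real_Iio (ν : Measure ℝ) [IsFiniteMeasure ν] :
    Measurable fun t => ν.real (Set.Iio t) :=
  Monotone.measurable fun _ _ h => measureReal_mono (Set.Iio_subset_Iio h)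

lemma measurable_real_Ioi (ν : Measure ℝ) [IsFiniteMeasure ν] :
    Measurable fun t => ν.real (Set.Ioi t) :=
  Antitone.measurable fun _ _ h => measureReal_mono (Set.Ioi_subset_Ioi h)

/-- The Hoeffding residual of the kernel `1(s < t)`, for `s` and `t` of laws `α` and `β`: the kernel
minus its two conditional expectations. It is not recentred, as only its variance and covariances
are used. -/
def pairResidual (α β : Measure ℝ) (s t : ℝ) : ℝ :=
  (if s < t then 1 else 0) - α.real (Set.Iio t) - β.real (Set.Ioi s)

lemma measurable_pairResidual (α β : Measure ℝ) [IsFiniteMeasure α] [IsFiniteMeasure β] :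
    Measurable fun p : ℝ × ℝ => pairResidual α β p.1 p.2 :=
  ((Measurable.ite (measurableSet_lt measurable_fst measurable_snd) measurable_const
    measurable_const).sub ((measurable_real_Iio α).comp measurable_snd)).sub
    ((measurable_real_Ioi β).comp measurable_fst)

section

variable (α β : Measure ℝ) [IsProbabilityMeasure α] [IsProbabilityMeasure β]

lemma pairResidual_mem_Icc (s t : ℝ) : pairResidual α β s t ∈ Set.Icc (-2) 1 := by
  have hα : 0 ≤ α.real (Set.Iio t) ∧ α.real (Set.Iio t) ≤ 1 := ⟨measureReal_nonneg,
    measureReal_le_one⟩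
  have hβ : 0 ≤ β.real (Set.Ioi s) ∧ β.real (Set.Ioi s) ≤ 1 := ⟨measureReal_nonneg,
    measureReal_le_one⟩
  rw [pairResidual, Set.mem_Icc]
  split_ifs <;> constructor <;> linarith

lemma integral_pairResidual_left (t : ℝ) :
    ∫ s, pairResidual α β s t ∂α = -∫ s, β.real (Set.Ioi s) ∂α := by
  have hind : Integrable ((Set.Iio t).indicator (1 : ℝ → ℝ)) α :=
    (integrable_const _).indicator measurableSet_Iio
  have hβ : Integrable (fun s => β.real (Set.Ioi s)) α :=
    .of_bound (measurable_real_Ioi β).aestronglyMeasurable 1 (ae_of_all _ fun s =>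
      (Real.norm_of_nonneg measureReal_nonneg).trans_le measureReal_le_one)
  have hα := integrable_const (μ := α) (α.real (Set.Iio t))
  have heq : ∀ s, pairResidual α β s t
      = (Set.Iio t).indicator 1 s - α.real (Set.Iio t) - β.real (Set.Ioi s) := fun s => by
    simp [pairResidual, Set.indicator_apply]
  simp_rw [heq]
  rw [integral_sub (by exact hind.sub hα) hβ, integral_sub hind hα,
    integral_indicator_one measurableSet_Iio, integral_const, probReal_univ, one_smul, sub_self,
    zero_sub]

lemma integral_pairResidual_right (s : ℝ) :
    ∫ t, pairResidual α β s t ∂β = -∫ t, α.real (Set.Iio t) ∂β := by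
  have hind : Integrable ((Set.Ioi s).indicator (1 : ℝ → ℝ)) β :=
    (integrable_const _).indicator measurableSet_Ioi
  have hα : Integrable (fun t => α.real (Set.Iio t)) β :=
    .of_bound (measurable_real_Iio α).aestronglyMeasurable 1 (ae_of_all _ fun t =>
      (Real.norm_of_nonneg measureReal_nonneg).trans_le measureReal_le_one)
  have hβ := integrable_const (μ := β) (β.real (Set.Ioi s))
  have heq : ∀ t, pairResidual α β s t
      = (Set.Ioi s).indicator 1 t - α.real (Set.Iio t) - β.real (Set.Ioi s) := fun t => by
    simp [pairResidual, Set.indicator_apply]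
  simp_rw [heq]
  rw [integral_sub (by exact hind.sub hα) hβ, integral_sub hind hα,
    integral_indicator_one measurableSet_Ioi, integral_const, probReal_univ, one_smul]
  ring

end

lemma measurable_pairResidual_eval {ι : Type*} (ν : ι → Measure ℝ) [∀ i, IsFiniteMeasure (ν i)]
    (i j : ι) : Measurable fun x : ι → ℝ => pairResidual (ν i) (ν j) (x i) (x j) :=
  (measurable_pairResidual (ν i) (ν j)).comp (f := fun x : ι → ℝ => (x i, x j)) (by fun_prop)

lemma memLp_pairResidual_eval {ι : Type*} [Fintype ι] (ν : ι → Measure ℝ)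
    [∀ i, IsProbabilityMeasure (ν i)] (i j : ι) :
    MemLp (fun x : ι → ℝ => pairResidual (ν i) (ν j) (x i) (x j)) 2 (Measure.pi ν) :=
  memLp_of_bounded (ae_of_all _ fun _ => pairResidual_mem_Icc _ _ _ _)
    (measurable_pairResidual_eval ν i j).aestronglyMeasurable 2

variable {ι : Type*} [LinearOrder ι]

lemma exists_mem_pair_notMem_pair {p q : ι × ι} (hp : p.2 < p.1) (hq : q.2 < q.1) (hpq : p ≠ q) :
    ∃ m, (m = q.1 ∨ m = q.2) ∧ m ≠ p.1 ∧ m ≠ p.2 := by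
  obtain ⟨i, j⟩ := p
  obtain ⟨k, l⟩ := q
  by_contra! h
  have hk : k = i ∨ k = j := or_iff_not_imp_left.2 (h k (.inl rfl))
  have hl : l = i ∨ l = j := or_iff_not_imp_left.2 (h l (.inr rfl))
  simp only [ne_eq, Prod.mk.injEq, not_and] at hp hq hpq
  grind

variable [Fintype ι]

/-- The weighted number of discordant pairs of `x`: every pair `j < i` with `x i < x j` counts
`w i`. -/
def rankSum (w x : ι → ℝ) : ℝ :=
  ∑ i, ∑ j, if j < i ∧ x i < x j then w i else 0

/-- The summand of coordinate `k` in the Hájek projection of `rankSum w` on the functions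
`∑ k, g k (x k)`, up to an additive constant, when the coordinates of `x` are independent with
laws `ν`. -/
def hajek (ν : ι → Measure ℝ) (w : ι → ℝ) (k : ι) (t : ℝ) : ℝ :=
  ∑ i with k < i, w i * (ν i).real (Set.Iio t) + w k * ∑ j with j < k, (ν j).real (Set.Ioi t)

lemma measurable_rankSum (w : ι → ℝ) : Measurable (rankSum w) :=
  Finset.measurable_sum _ fun i _ => Finset.measurable_sum _ fun j _ =>
    .ite ((MeasurableSet.const _).inter
      (measurableSet_lt (measurable_pi_apply i) (measurable_pi_apply j)))
      measurable_const measurable_const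

lemma measurable_hajek (ν : ι → Measure ℝ) [∀ i, IsFiniteMeasure (ν i)] (w : ι → ℝ) (k : ι) :
    Measurable (hajek ν w k) := by
  have hIio := fun i => measurable_real_Iio (ν i)
  have hIoi := fun i => measurable_real_Ioi (ν i)
  unfold hajek
  fun_prop

lemma rankSum_sub_sum_hajek (ν : ι → Measure ℝ) (w x : ι → ℝ) :
    rankSum w x - ∑ k, hajek ν w k (x k)
      = ∑ p : ι × ι with p.2 < p.1, w p.1 * pairResidual (ν p.1) (ν p.2) (x p.1) (x p.2) := by
  have hsum : ∑ k, hajek ν w k (x k) = ∑ i, ∑ j, if j < i then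
      w i * ((ν i).real (Set.Iio (x j)) + (ν j).real (Set.Ioi (x i))) else 0 := by
    simp only [hajek, Finset.sum_filter, Finset.mul_sum, mul_ite, mul_zero]
    rw [Finset.sum_add_distrib, Finset.sum_comm, ← Finset.sum_add_distrib]
    refine Finset.sum_congr rfl fun i _ => ?_
    rw [← Finset.sum_add_distrib]
    exact Finset.sum_congr rfl fun j _ => by split_ifs <;> ring
  rw [hsum, Finset.sum_filter, Fintype.sum_prod_type, rankSum, ← Finset.sum_sub_distrib]
  refine Finset.sum_congr rfl fun i _ => ?_
  rw [← Finset.sum_sub_distrib]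
  refine Finset.sum_congr rfl fun j _ => ?_
  unfold pairResidual
  by_cases hij : j < i <;> by_cases hx : x i < x j <;> simp only [hij, hx, true_and, false_and,
    if_true, if_false] <;> ring

variable (ν : ι → Measure ℝ) [∀ i, IsProbabilityMeasure (ν i)]

lemma covariance_pairResidual_eq_zero {p q : ι × ι} (hp : p.2 < p.1) (hq : q.2 < q.1)
    (hpq : p ≠ q) :
    cov[fun x => pairResidual (ν p.1) (ν p.2) (x p.1) (x p.2),
      fun x => pairResidual (ν q.1) (ν q.2) (x q.1) (x q.2); Measure.pi ν] = 0 := by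
  obtain ⟨m, hmq, hm₁, hm₂⟩ := exists_mem_pair_notMem_pair hp hq hpq
  have hfree : ∀ (x : ι → ℝ) (y : ℝ), pairResidual (ν p.1) (ν p.2) (Function.update x m y p.1)
      (Function.update x m y p.2) = pairResidual (ν p.1) (ν p.2) (x p.1) (x p.2) := fun x y => by
    rw [Function.update_of_ne hm₁.symm, Function.update_of_ne hm₂.symm]
  have hL2 := fun r : ι × ι => memLp_pairResidual_eval ν r.1 r.2
  rcases hmq with rfl | rfl
  · refine covariance_eq_zero_of_update ν _
      (c := -∫ s, (ν q.2).real (Set.Ioi s) ∂ν q.1) (hL2 p) (hL2 q) hfree fun x => ?_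
    simp only [Function.update_self, Function.update_of_ne hq.ne]
    exact integral_pairResidual_left _ _ _
  · refine covariance_eq_zero_of_update ν _
      (c := -∫ t, (ν q.1).real (Set.Iio t) ∂ν q.2) (hL2 p) (hL2 q) hfree fun x => ?_
    simp only [Function.update_self, Function.update_of_ne hq.ne']
    exact integral_pairResidual_right _ _ _

lemma variance_rankSum_sub_sum_hajek_le (w : ι → ℝ) :
    Var[fun x => rankSum w x - ∑ k, hajek ν w k (x k); Measure.pi ν]
      ≤ 9 / 4 * ∑ p : ι × ι with p.2 < p.1, w p.1 ^ 2 := by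
  simp_rw [rankSum_sub_sum_hajek]
  rw [variance_fun_sum' fun p _ => (memLp_pairResidual_eval ν p.1 p.2).const_mul (w p.1),
    Finset.mul_sum]
  refine Finset.sum_le_sum fun p hp => ?_
  have hp' : p.2 < p.1 := (Finset.mem_filter.1 hp).2
  have hvar : Var[fun x => pairResidual (ν p.1) (ν p.2) (x p.1) (x p.2); Measure.pi ν]
      ≤ 9 / 4 := by
    refine (variance_le_sq_of_bounded (ae_of_all _ fun _ => pairResidual_mem_Icc _ _ _ _)
      (measurable_pairResidual_eval ν p.1 p.2).aemeasurable).trans_eq (by norm_num)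
  rw [Finset.sum_eq_single_of_mem p hp fun q hq hqp => by
      rw [covariance_const_mul_left, covariance_const_mul_right,
        covariance_pairResidual_eq_zero ν hp' (Finset.mem_filter.1 hq).2 hqp.symm, mul_zero,
        mul_zero],
    covariance_const_mul_left, covariance_const_mul_right,
    covariance_self (measurable_pairResidual_eval ν p.1 p.2).aemeasurable]
  nlinarith [sq_nonneg (w p.1)]

end HoeffdingDecomposition

section AdmissibleWeights

/-- The weights covered by the limit theorem: constant weights, as for Kendall's tau, and the
weights `n / i` of the average-precision correlation are the two extreme cases. The weight of index
`0` is unconstrained, as no pair uses it. -/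
def AdmissibleWeight {n : ℕ} (w : Fin n → ℝ) : Prop :=
  ∀ i : Fin n, 0 < (i : ℕ) → 1 ≤ w i ∧ w i ≤ (n : ℝ) / ((i : ℕ) : ℝ)

lemma sum_fin_div_le (n : ℕ) :
    ∑ i : Fin n, (n : ℝ) / ((i : ℕ) : ℝ) ≤ n * (1 + Real.log n) := by
  obtain _ | m := n
  · simp
  have hharm : ∑ i ∈ Finset.range m, ((i : ℝ) + 1)⁻¹ ≤ 1 + Real.log m := by
    simpa [harmonic] using harmonic_le_one_add_log m
  have hlog : Real.log m ≤ Real.log (m + 1) := by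
    rcases m.eq_zero_or_pos with rfl | hm
    · simp
    · gcongr
      linarith
  simp_rw [div_eq_mul_inv]
  rw [← Finset.mul_sum, Fin.sum_univ_eq_sum_range (fun i => ((i : ℕ) : ℝ)⁻¹) (m + 1),
    Finset.sum_range_succ', Nat.cast_zero, inv_zero, add_zero]
  push_cast
  gcongr
  exact hharm.trans (by gcongr)

variable {n : ℕ} {w : Fin n → ℝ}

lemma admissibleWeight_one : AdmissibleWeight fun _ : Fin n => 1 := fun i hi =>
  ⟨le_rfl, (one_le_div (by exact_mod_cast hi)).2 (by exact_mod_cast i.isLt.le)⟩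

lemma admissibleWeight_div : AdmissibleWeight fun i : Fin n => (n : ℝ) / ((i : ℕ) : ℝ) :=
  fun i hi => ⟨(one_le_div (by exact_mod_cast hi)).2 (by exact_mod_cast i.isLt.le), le_rfl⟩

namespace AdmissibleWeight

lemma nonneg_of_lt (hw : AdmissibleWeight w) {i j : Fin n} (h : j < i) : 0 ≤ w i :=
  zero_le_one.trans (hw i ((Nat.zero_le _).trans_lt h)).1

lemma le_div_of_lt (hw : AdmissibleWeight w) {i j : Fin n} (h : j < i) :
    w i ≤ (n : ℝ) / ((i : ℕ) : ℝ) :=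
  (hw i ((Nat.zero_le _).trans_lt h)).2

lemma mul_val_le (hw : AdmissibleWeight w) (k : Fin n) : w k * (k : ℕ) ≤ n := by
  rcases (k : ℕ).eq_zero_or_pos with hk | hk
  · simp [hk]
  · exact (le_div_iff₀ (by exact_mod_cast hk)).1 (hw k hk).2

lemma sum_lt_le (hw : AdmissibleWeight w) (k : Fin n) :
    ∑ i with k < i, w i ≤ n * (1 + Real.log n) := by
  calc ∑ i with k < i, w i ≤ ∑ i with k < i, (n : ℝ) / ((i : ℕ) : ℝ) :=
        Finset.sum_le_sum fun i hi => hw.le_div_of_lt (Finset.mem_filter.1 hi).2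
    _ ≤ ∑ i : Fin n, (n : ℝ) / ((i : ℕ) : ℝ) :=
        Finset.sum_le_univ_sum_of_nonneg fun i => by positivity
    _ ≤ n * (1 + Real.log n) := sum_fin_div_le n

lemma sum_lt_le_of_le_two_mul (hw : AdmissibleWeight w) {k : Fin n}
    (hk : (n : ℝ) ≤ 2 * (k : ℕ)) : ∑ i with k < i, w i ≤ 2 * (n - (k : ℕ)) := by
  have hkn : (k : ℕ) + 1 ≤ n := k.isLt
  have hcard : ((Finset.Ioi k).card : ℝ) ≤ n - (k : ℕ) := by
    rw [Fin.card_Ioi, Nat.sub_right_comm, Nat.cast_sub (by omega), Nat.cast_sub k.isLt.le]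
    simp
  rw [Finset.filter_lt_eq_Ioi]
  calc ∑ i ∈ Finset.Ioi k, w i ≤ (Finset.Ioi k).card • (2 : ℝ) := by
        refine Finset.sum_le_card_nsmul _ _ _ fun i hi => ?_
        have hki : k < i := Finset.mem_Ioi.1 hi
        have hki' : ((k : ℕ) : ℝ) < (i : ℕ) := by exact_mod_cast hki
        exact (hw.le_div_of_lt hki).trans
          ((div_le_iff₀ (hki'.trans_le' (Nat.cast_nonneg _))).2 (by linarith))
    _ ≤ 2 * (n - (k : ℕ)) := by rw [nsmul_eq_mul]; linarith

lemma sum_sq_le (hw : AdmissibleWeight w) :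
    ∑ p : Fin n × Fin n with p.2 < p.1, w p.1 ^ 2 ≤ n ^ 2 * (1 + Real.log n) := by
  have hrow : ∀ i : Fin n, ∑ j with j < i, w i ^ 2 ≤ n * (n / ((i : ℕ) : ℝ)) := fun i => by
    rw [Finset.sum_const, Finset.filter_gt_eq_Iio, Fin.card_Iio, nsmul_eq_mul]
    rcases (i : ℕ).eq_zero_or_pos with hi | hi
    · simp [hi]
    · calc ((i : ℕ) : ℝ) * w i ^ 2 = w i * (i : ℕ) * w i := by ring
        _ ≤ n * (n / ((i : ℕ) : ℝ)) := mul_le_mul (hw.mul_val_le i) (hw i hi).2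
            (zero_le_one.trans (hw i hi).1) (Nat.cast_nonneg n)
  rw [Finset.sum_filter, Fintype.sum_prod_type]
  simp only [← Finset.sum_filter]
  calc ∑ i, ∑ j with j < i, w i ^ 2 ≤ ∑ i : Fin n, n * (n / ((i : ℕ) : ℝ)) :=
        Finset.sum_le_sum fun i _ => hrow i
    _ = n * ∑ i : Fin n, (n : ℝ) / ((i : ℕ) : ℝ) := Finset.mul_sum .. |>.symm
    _ ≤ n * (n * (1 + Real.log n)) := by gcongr; exact sum_fin_div_le n
    _ = n ^ 2 * (1 + Real.log n) := by ring

lemma hajek_mem_Icc (hw : AdmissibleWeight w) (ν : Fin n → Measure ℝ)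
    [∀ i, IsProbabilityMeasure (ν i)] (k : Fin n) (t : ℝ) :
    hajek ν w k t ∈ Set.Icc 0 (n * (2 + Real.log n)) := by
  have habove : ∑ i with k < i, w i * (ν i).real (Set.Iio t)
      ∈ Set.Icc 0 (n * (1 + Real.log n)) := by
    refine ⟨Finset.sum_nonneg fun i hi => ?_,
      (Finset.sum_le_sum fun i hi => ?_).trans (hw.sum_lt_le k)⟩
    · exact mul_nonneg (hw.nonneg_of_lt (Finset.mem_filter.1 hi).2) measureReal_nonneg
    · exact mul_le_of_le_one_right (hw.nonneg_of_lt (Finset.mem_filter.1 hi).2) measureReal_le_one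
  have hcard : ∑ j with j < k, (ν j).real (Set.Ioi t) ≤ (k : ℕ) := by
    calc ∑ j with j < k, (ν j).real (Set.Ioi t) ≤ ∑ j with j < k, (1 : ℝ) :=
          Finset.sum_le_sum fun j _ => measureReal_le_one
      _ = (k : ℕ) := by
          rw [Finset.sum_const, Finset.filter_gt_eq_Iio, Fin.card_Iio, nsmul_eq_mul, mul_one]
  have hbelow : w k * ∑ j with j < k, (ν j).real (Set.Ioi t) ∈ Set.Icc 0 (n : ℝ) := by
    rcases (k : ℕ).eq_zero_or_pos with hk | hk
    · have hempty : Finset.univ.filter (fun j : Fin n => j < k) = ∅ := by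
        rw [Finset.filter_gt_eq_Iio, ← Finset.card_eq_zero, Fin.card_Iio, hk]
      simp [hempty]
    · have hwk := zero_le_one.trans (hw k hk).1
      exact ⟨mul_nonneg hwk (Finset.sum_nonneg fun j _ => measureReal_nonneg),
        (mul_le_mul_of_nonneg_left hcard hwk).trans (hw.mul_val_le k)⟩
  rw [hajek]
  exact ⟨add_nonneg habove.1 hbelow.1, by linarith [habove.2, hbelow.2]⟩

end AdmissibleWeight

end AdmissibleWeights

section VarianceLowerBounds

lemma abs_sub_integral_le_of_mem_Icc {Ω : Type*} [MeasurableSpace Ω] {P : Measure Ω}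
    [IsProbabilityMeasure P] {f : Ω → ℝ} {a b : ℝ} (hf : AEStronglyMeasurable f P)
    (hab : ∀ ω, f ω ∈ Set.Icc a b) (ω : Ω) : |f ω - ∫ ω', f ω' ∂P| ≤ b - a := by
  have hint : Integrable f P := (memLp_of_bounded (ae_of_all _ hab) hf 1).integrable le_rfl
  have hlower : a ≤ ∫ ω', f ω' ∂P := by
    simpa using integral_mono (integrable_const a) hint fun ω => (hab ω).1
  have hupper : ∫ ω', f ω' ∂P ≤ b := by
    simpa using integral_mono hint (integrable_const b) fun ω => (hab ω).2
  rw [abs_le]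
  constructor <;> linarith [(hab ω).1, (hab ω).2]

variable {Ω : Type*} [MeasurableSpace Ω] {P : Measure Ω} [IsProbabilityMeasure P] {f : Ω → ℝ}

lemma sq_mul_measureReal_le_variance (hf : MemLp f 2 P) {d : ℝ} (hd : 0 < d) {s : Set Ω}
    (hs : ∀ x ∈ s, d ≤ |f x - ∫ y, f y ∂P|) : d ^ 2 * P.real s ≤ Var[f; P] := by
  have hcheb : P.real s ≤ Var[f; P] / d ^ 2 :=
    ENNReal.toReal_le_of_le_ofReal (div_nonneg (variance_nonneg f P) (sq_nonneg d))
      ((measure_mono hs).trans (meas_ge_le_variance_div_sq hf hd))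
  rwa [le_div_iff₀ (by positivity), mul_comm] at hcheb

lemma sq_mul_measureReal_mul_measureReal_le_variance (hf : MemLp f 2 P) {δ : ℝ} (hδ : 0 < δ)
    {s t : Set Ω} (hst : ∀ x ∈ s, ∀ y ∈ t, δ ≤ f x - f y) :
    δ ^ 2 / 4 * (P.real s * P.real t) ≤ Var[f; P] := by
  have hhalf : δ ^ 2 / 4 = (δ / 2) ^ 2 := by ring
  rw [hhalf]
  by_cases hs : ∀ x ∈ s, δ / 2 ≤ |f x - ∫ y, f y ∂P|
  · refine le_trans ?_ (sq_mul_measureReal_le_variance hf (half_pos hδ) hs)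
    gcongr
    exact mul_le_of_le_one_right measureReal_nonneg measureReal_le_one
  · push Not at hs
    obtain ⟨x, hx, hxs⟩ := hs
    refine le_trans ?_ (sq_mul_measureReal_le_variance hf (half_pos hδ) (s := t) fun y hy => ?_)
    · gcongr
      exact mul_le_of_le_one_left measureReal_nonneg measureReal_le_one
    · have hxy := hst x hx y hy
      have hx' := (abs_lt.1 hxs).2
      exact le_trans (by linarith) (neg_le_abs _)

lemma memLp_indicator_one {s : Set Ω} (hs : MeasurableSet s) :
    MemLp (s.indicator (1 : Ω → ℝ)) 2 P :=
  memLp_indicator_const 2 hs 1 (.inr (measure_ne_top _ _))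

lemma covariance_indicator_one (hf : MemLp f 2 P) {s : Set Ω} (hs : MeasurableSet s) :
    cov[f, s.indicator 1; P] = ∫ ω in s, (f ω - ∫ ω', f ω' ∂P) ∂P := by
  have hint := hf.integrable one_le_two
  rw [covariance_eq_sub hf (memLp_indicator_one hs),
    integral_indicator_one hs, integral_sub hint.integrableOn (integrable_const _),
    setIntegral_const, smul_eq_mul, mul_comm (P.real s), ← integral_indicator hs]
  congr 2
  exact funext fun ω => by by_cases hω : ω ∈ s <;> simp [hω]

lemma variance_indicator_one_le {s : Set Ω} (hs : MeasurableSet s) :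
    Var[s.indicator (1 : Ω → ℝ); P] ≤ P.real sᶜ := by
  have hsq : s.indicator (1 : Ω → ℝ) ^ 2 = s.indicator 1 := funext fun ω => by
    by_cases hω : ω ∈ s <;> simp [hω]
  rw [variance_eq_sub (memLp_indicator_one hs), hsq,
    integral_indicator_one hs, probReal_compl_eq_one_sub hs]
  nlinarith [measureReal_nonneg (μ := P) (s := s), measureReal_le_one (μ := P) (s := s)]

lemma sq_mul_measureReal_le_variance_mul_measureReal_le_integral (hfm : Measurable f)
    (hf : MemLp f 2 P) {c : ℝ} (hc : 0 ≤ c) :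
    (c * P.real {ω | c < f ω - ∫ ω', f ω' ∂P}) ^ 2
      ≤ Var[f; P] * P.real {ω | f ω ≤ ∫ ω', f ω' ∂P} := by
  set m := ∫ ω, f ω ∂P
  have habove : MeasurableSet {ω | m < f ω} := measurableSet_lt measurable_const hfm
  have htail : MeasurableSet {ω | c < f ω - m} :=
    measurableSet_lt measurable_const (hfm.sub_const m)
  have hsub : {ω | c < f ω - m} ⊆ {ω | m < f ω} := fun ω hω => sub_pos.1 (hc.trans_lt hω)
  have hint : Integrable (fun ω => f ω - m) P :=
    (hf.integrable one_le_two).sub (integrable_const m)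
  have hle_cov : c * P.real {ω | c < f ω - m} ≤ cov[f, {ω | m < f ω}.indicator 1; P] := by
    rw [covariance_indicator_one hf habove]
    calc c * P.real {ω | c < f ω - m} ≤ ∫ ω in {ω | c < f ω - m}, (f ω - m) ∂P :=
          setIntegral_ge_of_const_le_real htail (measure_ne_top _ _) (fun ω hω => hω.le)
            hint.integrableOn
      _ ≤ ∫ ω in {ω | m < f ω}, (f ω - m) ∂P :=
          setIntegral_mono_set hint.integrableOn
            (ae_restrict_of_forall_mem habove fun ω hω => (sub_pos.2 hω).le)
            (ae_of_all _ hsub)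
  have hcompl : {ω | m < f ω}ᶜ = {ω | f ω ≤ m} := by ext; simp
  calc (c * P.real {ω | c < f ω - m}) ^ 2 ≤ cov[f, {ω | m < f ω}.indicator 1; P] ^ 2 := by gcongr
    _ ≤ Var[f; P] * Var[{ω | m < f ω}.indicator 1; P] :=
        sq_covariance_le hf (memLp_indicator_one habove)
    _ ≤ Var[f; P] * P.real {ω | f ω ≤ m} := by
        rw [← hcompl]
        exact mul_le_mul_of_nonneg_left (variance_indicator_one_le habove) (variance_nonneg f P)

end VarianceLowerBounds

section HajekVariance

variable {n : ℕ} {w : Fin n → ℝ}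

lemma AdmissibleWeight.memLp_hajek (hw : AdmissibleWeight w) (ν : Fin n → Measure ℝ)
    [∀ i, IsProbabilityMeasure (ν i)] (k : Fin n) : MemLp (hajek ν w k) 2 (ν k) :=
  memLp_of_bounded (ae_of_all _ (hw.hajek_mem_Icc ν k))
    (measurable_hajek ν w k).aestronglyMeasurable 2

lemma AdmissibleWeight.le_hajek_sub_hajek (hw : AdmissibleWeight w) (ν : Fin n → Measure ℝ)
    [∀ i, IsProbabilityMeasure (ν i)] {k : Fin n} (hk : 0 ≤ w k) {a b x y : ℝ} (hxa : x ≤ a)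
    (hby : b ≤ y) :
    w k * ∑ j with j < k, ((ν j).real (Set.Ioi a) - (ν j).real (Set.Ioi b)) - ∑ i with k < i, w i
      ≤ hajek ν w k x - hajek ν w k y := by
  have hbelow : ∑ j with j < k, ((ν j).real (Set.Ioi a) - (ν j).real (Set.Ioi b))
      ≤ ∑ j with j < k, (ν j).real (Set.Ioi x) - ∑ j with j < k, (ν j).real (Set.Ioi y) := by
    rw [← Finset.sum_sub_distrib]
    exact Finset.sum_le_sum fun j _ => sub_le_sub
      (measureReal_mono (Set.Ioi_subset_Ioi hxa)) (measureReal_mono (Set.Ioi_subset_Ioi hby))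
  have habove : ∀ i ∈ Finset.univ.filter (fun i => k < i), 0 ≤ w i := fun i hi =>
    hw.nonneg_of_lt (Finset.mem_filter.1 hi).2
  have hx : 0 ≤ ∑ i with k < i, w i * (ν i).real (Set.Iio x) :=
    Finset.sum_nonneg fun i hi => mul_nonneg (habove i hi) measureReal_nonneg
  have hy : ∑ i with k < i, w i * (ν i).real (Set.Iio y) ≤ ∑ i with k < i, w i :=
    Finset.sum_le_sum fun i hi => mul_le_of_le_one_right (habove i hi) measureReal_le_one
  have := mul_le_mul_of_nonneg_left hbelow hk
  rw [hajek, hajek]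
  linarith

lemma AdmissibleWeight.le_variance_hajek (hw : AdmissibleWeight w) (ν : Fin n → Measure ℝ)
    [∀ i, IsProbabilityMeasure (ν i)] {k : Fin n} {a b r : ℝ} (hr : 0 < r) (hr1 : r ≤ 1)
    (hk : (n : ℝ) - (k : ℕ) ≤ n * r / 8)
    (hgap : ∀ j, j ≠ k → r ≤ (ν j).real (Set.Ioi a) - (ν j).real (Set.Ioi b)) :
    (n * r) ^ 2 / 16 * ((ν k).real (Set.Iic a) * (ν k).real (Set.Ioi b))
      ≤ Var[hajek ν w k; ν k] := by
  have hn : (0 : ℝ) < n := by exact_mod_cast k.pos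
  have hnr : n * r ≤ n := mul_le_of_le_one_right hn.le hr1
  have hk0 : (0 : ℝ) < (k : ℕ) := by linarith
  have hwk := (hw k (by exact_mod_cast hk0)).1
  have hbelow :
      (k : ℕ) * r ≤ ∑ j with j < k, ((ν j).real (Set.Ioi a) - (ν j).real (Set.Ioi b)) := by
    have hcard : (Finset.univ.filter (fun j : Fin n => j < k)).card = (k : ℕ) := by
      rw [Finset.filter_gt_eq_Iio, Fin.card_Iio]
    rw [← nsmul_eq_mul, ← hcard]
    exact Finset.card_nsmul_le_sum _ _ _ fun j hj => hgap j (Finset.mem_filter.1 hj).2.ne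
  have habove := hw.sum_lt_le_of_le_two_mul (k := k) (by linarith)
  have hgap_hajek : ∀ x ∈ Set.Iic a, ∀ y ∈ Set.Ioi b,
      n * r / 2 ≤ hajek ν w k x - hajek ν w k y := fun x hx y hy => by
    refine le_trans ?_ (hw.le_hajek_sub_hajek ν (zero_le_one.trans hwk) hx (le_of_lt hy))
    have hkr : (k : ℕ) * r ≤ w k * ((k : ℕ) * r) := le_mul_of_one_le_left (by positivity) hwk
    have hmul := mul_le_mul_of_nonneg_left hbelow (zero_le_one.trans hwk)
    nlinarith
  refine le_trans (le_of_eq ?_) (sq_mul_measureReal_mul_measureReal_le_variance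
    (hw.memLp_hajek ν k) (by positivity) hgap_hajek)
  ring

lemma mul_le_sum_of_forall_last {f : Fin n → ℝ} (hf : ∀ k, 0 ≤ f k) {c y : ℝ} (hc : 0 ≤ c)
    (hy : 1 ≤ y) (hyn : y ≤ n) (h : ∀ k : Fin n, (n : ℝ) - (k : ℕ) ≤ y → c ≤ f k) :
    y / 2 * c ≤ ∑ k, f k := by
  have hfloor_pos : 1 ≤ ⌊y⌋₊ := Nat.le_floor (by simpa using hy)
  have hfloor_le : (⌊y⌋₊ : ℝ) ≤ y := Nat.floor_le (by linarith)
  have hfloor_n : ⌊y⌋₊ ≤ n := by exact_mod_cast hfloor_le.trans hyn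
  have hone : (1 : ℝ) ≤ ⌊y⌋₊ := by exact_mod_cast hfloor_pos
  have hlt := Nat.lt_floor_add_one y
  let first : Fin n := ⟨n - ⌊y⌋₊, by omega⟩
  calc y / 2 * c ≤ ⌊y⌋₊ * c := by gcongr; linarith
    _ = (Finset.Ici first).card • c := by
        rw [Fin.card_Ici, Nat.sub_sub_self hfloor_n, nsmul_eq_mul]
    _ ≤ ∑ k ∈ Finset.Ici first, f k := by
        refine Finset.card_nsmul_le_sum _ _ _ fun k hk => h k ?_
        have hk' : n - ⌊y⌋₊ ≤ (k : ℕ) := (Finset.mem_Ici.1 hk : first ≤ k)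
        have : (n : ℝ) ≤ (k : ℕ) + ⌊y⌋₊ := by exact_mod_cast (by omega : n ≤ (k : ℕ) + ⌊y⌋₊)
        linarith
    _ ≤ ∑ k, f k := Finset.sum_le_univ_sum_of_nonneg hf

end HajekVariance

section Rows

variable {n : ℕ}

lemma le_spread (μ σ : Fin n → ℝ) {i j : Fin n} (h : i ≠ j) :
    |(μ i - μ j) / σ i| ≤ spread μ σ :=
  le_ciSup (f := fun p : {p : Fin n × Fin n // p.1 ≠ p.2} =>
    |(μ p.1.1 - μ p.1.2) / σ p.1.1|) (Set.finite_range _).bddAbove ⟨(i, j), h⟩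

lemma le_scaleRatio (σ : Fin n → ℝ) {i j : Fin n} (h : i ≠ j) : σ i / σ j ≤ scaleRatio σ :=
  le_ciSup (f := fun p : {p : Fin n × Fin n // p.1 ≠ p.2} => σ p.1.1 / σ p.1.2)
    (Set.finite_range _).bddAbove ⟨(i, j), h⟩

lemma spread_nonneg (μ σ : Fin n → ℝ) : 0 ≤ spread μ σ :=
  Real.iSup_nonneg fun _ => abs_nonneg _

lemma one_le_scaleRatio (hn : 2 ≤ n) {σ : Fin n → ℝ} (hσ : ∀ i, 0 < σ i) : 1 ≤ scaleRatio σ := by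
  obtain ⟨i, j, hij⟩ := (Fin.nontrivial_iff_two_le.2 hn).exists_pair_ne
  rcases le_total (σ i) (σ j) with h | h
  · exact ((one_le_div (hσ _)).2 h).trans (le_scaleRatio σ hij.symm)
  · exact ((one_le_div (hσ _)).2 h).trans (le_scaleRatio σ hij)

lemma le_spread_add_mul_scaleRatio (hn : 2 ≤ n) (μ : Fin n → ℝ) {σ : Fin n → ℝ}
    (hσ : ∀ i, 0 < σ i) {M : ℝ} (hM : 0 ≤ M) : M ≤ spread μ σ + M * scaleRatio σ :=
  (le_mul_of_one_le_right hM (one_le_scaleRatio hn hσ)).trans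
    (le_add_of_nonneg_left (spread_nonneg μ σ))

lemma sub_le_spread_mul {μ σ : Fin n → ℝ} {i j : Fin n} (hσ : 0 < σ i) (h : i ≠ j) :
    μ j - μ i ≤ spread μ σ * σ i := by
  have := (neg_le_abs _).trans (le_spread μ σ h)
  rwa [← neg_div, neg_sub, div_le_iff₀ hσ] at this

/-- One row of the location-scale model of `LocationScale`, for arbitrary laws: they may have
atoms. -/
structure IndepLocationScale {Ω : Type*} [MeasurableSpace Ω] (P : Measure Ω)
    (X : Fin n → Ω → ℝ) (μ σ : Fin n → ℝ) : Prop where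
  measurable : ∀ i, Measurable (X i)
  indep : iIndepFun X P
  memLp : ∀ i, MemLp (X i) 2 P
  mean : ∀ i, ∫ ω, X i ω ∂P = μ i
  sigma_pos : ∀ i, 0 < σ i
  variance : ∀ i, Var[X i; P] = σ i ^ 2

variable {Ω : Type*} [MeasurableSpace Ω] {P : Measure Ω} {X : Fin n → Ω → ℝ} {μ σ : Fin n → ℝ}

lemma LocationScale.indepLocationScale (h : LocationScale P X μ σ) : IndepLocationScale P X μ σ :=
  ⟨h.measurable, h.indep, h.memLp, h.mean, h.sigma_pos, h.variance⟩

namespace IndepLocationScale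

section

variable [IsFiniteMeasure P]

lemma survival_le_measureReal_Ioi (h : IndepLocationScale P X μ σ) (j : Fin n) {t y : ℝ}
    (hy : y ≤ μ j + t * σ j) : survival P X μ σ j t ≤ (P.map (X j)).real (Set.Ioi y) := by
  rw [map_measureReal_apply (h.measurable j) measurableSet_Ioi]
  refine measureReal_mono fun ω hω => ?_
  have hω' : t * σ j < X j ω - μ j := (lt_div_iff₀ (h.sigma_pos j)).1 hω
  exact (by linarith : y < X j ω)

lemma measureReal_Ioi_le_survival (h : IndepLocationScale P X μ σ) (j : Fin n) {t y : ℝ}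
    (hy : μ j + t * σ j ≤ y) : (P.map (X j)).real (Set.Ioi y) ≤ survival P X μ σ j t := by
  rw [map_measureReal_apply (h.measurable j) measurableSet_Ioi]
  refine measureReal_mono fun ω hω => ?_
  have hω' : y < X j ω := hω
  exact (lt_div_iff₀ (h.sigma_pos j)).2 (by linarith)

end

variable [IsProbabilityMeasure P]

lemma sq_survival_le_measureReal_Iic (h : IndepLocationScale P X μ σ) (k : Fin n) {t : ℝ}
    (ht : 0 ≤ t) : (t * survival P X μ σ k t) ^ 2 ≤ (P.map (X k)).real (Set.Iic (μ k)) := by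
  have hσ := h.sigma_pos k
  have hsurv : survival P X μ σ k t = P.real {ω | t * σ k < X k ω - μ k} := by
    simp only [survival, lt_div_iff₀ hσ]
  have hcs := sq_mul_measureReal_le_variance_mul_measureReal_le_integral (h.measurable k)
    (h.memLp k) (mul_nonneg ht hσ.le)
  rw [h.mean, h.variance, ← hsurv] at hcs
  rw [map_measureReal_apply (h.measurable k) measurableSet_Iic]
  refine le_of_mul_le_mul_left (le_trans (le_of_eq ?_) hcs) (pow_pos hσ 2)
  ring

lemma le_measureReal_Ioi_sub_measureReal_Ioi (h : IndepLocationScale P X μ σ) {j k : Fin n}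
    (hjk : j ≠ k) {m M r : ℝ} (hm : spread μ σ ≤ m) (hM : 0 ≤ M)
    (hlower : 2 * r ≤ survival P X μ σ j m) (hupper : survival P X μ σ j M ≤ r) :
    r ≤ (P.map (X j)).real (Set.Ioi (μ k))
      - (P.map (X j)).real (Set.Ioi (μ k + (spread μ σ + M * scaleRatio σ) * σ k)) := by
  have hσj := h.sigma_pos j
  have hσk := h.sigma_pos k
  have hnear : 2 * r ≤ (P.map (X j)).real (Set.Ioi (μ k)) := by
    refine hlower.trans (h.survival_le_measureReal_Ioi j ?_)
    have := mul_le_mul_of_nonneg_right hm hσj.le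
    linarith [sub_le_spread_mul (μ := μ) hσj hjk]
  have hfar : (P.map (X j)).real (Set.Ioi (μ k + (spread μ σ + M * scaleRatio σ) * σ k)) ≤ r := by
    refine (h.measureReal_Ioi_le_survival j ?_).trans hupper
    have hscale : M * σ j ≤ M * (scaleRatio σ * σ k) :=
      mul_le_mul_of_nonneg_left ((div_le_iff₀ hσk).1 (le_scaleRatio σ hjk)) hM
    linarith [sub_le_spread_mul (μ := μ) hσk hjk.symm]
  linarith

lemma le_sum_variance_hajek (h : IndepLocationScale P X μ σ) {w : Fin n → ℝ}
    (hw : AdmissibleWeight w) {t₀ a r τ m M : ℝ} (ht₀ : 0 ≤ t₀) (ha : 0 ≤ a) (hr : 0 < r)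
    (hτ : 0 ≤ τ) (hm : spread μ σ ≤ m) (hM : 0 ≤ M) (hnr : 8 ≤ n * r)
    (hsurv_t₀ : ∀ j, a ≤ survival P X μ σ j t₀) (hsurv_m : ∀ j, 2 * r ≤ survival P X μ σ j m)
    (hsurv_M : ∀ j, survival P X μ σ j M ≤ r)
    (hsurv_far : ∀ j, τ ≤ survival P X μ σ j (spread μ σ + M * scaleRatio σ)) :
    (t₀ * a) ^ 2 / 256 * (n ^ 3 * (r ^ 3 * τ))
      ≤ ∑ k, Var[hajek (fun i => P.map (X i)) w k; P.map (X k)] := by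
  have hprob : ∀ i, IsProbabilityMeasure (P.map (X i)) := fun i =>
    Measure.isProbabilityMeasure_map (h.measurable i).aemeasurable
  have hn : 0 < n := Nat.pos_of_ne_zero fun hn => by norm_num [hn] at hnr
  have hr1 : 2 * r ≤ 1 := (hsurv_m ⟨0, hn⟩).trans measureReal_le_one
  have : (0 : ℝ) < n := by exact_mod_cast hn
  have hlast : ∀ k : Fin n, (n : ℝ) - (k : ℕ) ≤ n * r / 8 →
      (n * r) ^ 2 / 16 * ((t₀ * a) ^ 2 * τ)
        ≤ Var[hajek (fun i => P.map (X i)) w k; P.map (X k)] := fun k hk => by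
    refine le_trans ?_ (hw.le_variance_hajek (fun i => P.map (X i)) hr (by linarith) hk
      fun j hj => h.le_measureReal_Ioi_sub_measureReal_Ioi hj hm hM (hsurv_m j) (hsurv_M j))
    gcongr
    · refine le_trans ?_ (h.sq_survival_le_measureReal_Iic k ht₀)
      gcongr
      exact hsurv_t₀ k
    · exact (hsurv_far k).trans (h.survival_le_measureReal_Ioi k le_rfl)
  refine le_trans (le_of_eq ?_) (mul_le_sum_of_forall_last (fun k => variance_nonneg _ _)
    (by positivity) (by linarith) (by nlinarith) hlast)
  ring

end IndepLocationScale

end Rows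

section RankSumCLT

lemma abs_rankSum_le {ι : Type*} [LinearOrder ι] [Fintype ι] (w x : ι → ℝ) :
    |rankSum w x| ≤ ∑ i, ∑ _j : ι, |w i| := by
  refine (Finset.abs_sum_le_sum_abs _ _).trans (Finset.sum_le_sum fun i _ =>
    (Finset.abs_sum_le_sum_abs _ _).trans (Finset.sum_le_sum fun j _ => ?_))
  split_ifs
  · exact le_rfl
  · simp

lemma variance_sum_comp {ι Ω : Type*} [Fintype ι] [MeasurableSpace Ω] {P : Measure Ω}
    {α : ι → Type*} [∀ i, MeasurableSpace (α i)] {Z : ∀ i, Ω → α i} (hZ : ∀ i, Measurable (Z i))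
    (hindep : iIndepFun Z P) {f : ∀ i, α i → ℝ}
    (hfm : ∀ i, Measurable (f i)) (hf : ∀ i, MemLp (f i) 2 (P.map (Z i))) :
    Var[∑ i, fun ω => f i (Z i ω); P] = ∑ i, Var[f i; P.map (Z i)] := by
  have hindep' : iIndepFun (fun i ω => f i (Z i ω)) P := hindep.comp f hfm
  refine (IndepFun.variance_sum (X := fun i ω => f i (Z i ω)) (fun i _ =>
    (hf i).comp_of_map (hZ i).aemeasurable) fun i _ j _ hij => hindep'.indepFun hij).trans ?_
  exact Finset.sum_congr rfl fun i _ =>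
    (variance_map (hfm i).aemeasurable (hZ i).aemeasurable).symm

section

variable {ι Ω : Type*} [LinearOrder ι] [Fintype ι] [MeasurableSpace Ω] {P : Measure Ω}
  [IsProbabilityMeasure P] {X : ι → Ω → ℝ}

lemma memLp_rankSum_comp (w : ι → ℝ) (hX : ∀ i, Measurable (X i)) :
    MemLp (fun ω => rankSum w fun i => X i ω) 2 P :=
  MemLp.of_bound ((measurable_rankSum w).comp (measurable_pi_iff.2 hX)).aestronglyMeasurable _
    (ae_of_all _ fun _ => abs_rankSum_le w _)

lemma variance_rankSum_comp_sub_sum_hajek_le (w : ι → ℝ) (hX : ∀ i, Measurable (X i))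
    (hindep : iIndepFun X P) :
    Var[(fun ω => rankSum w fun i => X i ω) -
        ∑ k, fun ω => hajek (fun i => P.map (X i)) w k (X k ω); P]
      ≤ 9 / 4 * ∑ p : ι × ι with p.2 < p.1, w p.1 ^ 2 := by
  have hprob : ∀ i, IsProbabilityMeasure (P.map (X i)) := fun i =>
    Measure.isProbabilityMeasure_map (hX i).aemeasurable
  refine le_trans (le_of_eq ?_) (variance_rankSum_sub_sum_hajek_le (fun i => P.map (X i)) w)
  have hmeas : Measurable fun x : ι → ℝ =>
      rankSum w x - ∑ k, hajek (fun i => P.map (X i)) w k (x k) :=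
    (measurable_rankSum w).sub (Finset.measurable_fun_sum _ fun k _ =>
      (measurable_hajek _ w k).comp (measurable_pi_apply k))
  rw [← hindep.map_fun_eq_pi_map fun i => (hX i).aemeasurable, variance_map hmeas.aemeasurable
    (measurable_pi_iff.2 hX).aemeasurable]
  congr 1
  ext ω
  simp only [Pi.sub_apply, Finset.sum_apply, Function.comp_apply]

end

variable {Ω : ℕ → Type*} [∀ n, MeasurableSpace (Ω n)] {P : ∀ n, Measure (Ω n)}
  [∀ n, IsProbabilityMeasure (P n)] {X : ∀ n, Fin n → Ω n → ℝ} {w : ∀ n, Fin n → ℝ}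

lemma isBigO_mul_two_add_log :
    (fun n : ℕ => n * (2 + Real.log n)) =O[atTop] fun n : ℕ => n * Real.log n := by
  refine (isBigO_refl _ _).mul ((isLittleO_const_left.2 (.inr ?_)).isBigO.add (isBigO_refl _ _))
  exact tendsto_norm_atTop_atTop.comp (Real.tendsto_log_atTop.comp tendsto_natCast_atTop_atTop)

lemma asymptoticallyNormal_rankSum_of_isLittleO (hX : ∀ n i, Measurable (X n i))
    (hindep : ∀ n, iIndepFun (X n) (P n)) (hw : ∀ n, AdmissibleWeight (w n))
    (hvar : (fun n : ℕ => (n * Real.log n) ^ 2) =o[atTop] fun n =>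
      ∑ k, Var[hajek (fun i => (P n).map (X n i)) (w n) k; (P n).map (X n k)]) :
    AsymptoticallyNormal P (fun n ω => rankSum (w n) fun i => X n i ω) := by
  have hprob : ∀ n i, IsProbabilityMeasure ((P n).map (X n i)) := fun n i =>
    Measure.isProbabilityMeasure_map (hX n i).aemeasurable
  set Y : ∀ n, Fin n → Ω n → ℝ := fun n k ω =>
    hajek (fun i => (P n).map (X n i)) (w n) k (X n k ω)
  have hYindep : ∀ n, iIndepFun (Y n) (P n) := fun n =>
    (hindep n).comp _ fun k => measurable_hajek _ (w n) k
  have hYmem : ∀ n k, MemLp (Y n k) 2 (P n) := fun n k =>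
    ((hw n).memLp_hajek (fun i => (P n).map (X n i)) k).comp_of_map (hX n k).aemeasurable
  have hYvar : ∀ n, Var[∑ k, Y n k; P n]
      = ∑ k, Var[hajek (fun i => (P n).map (X n i)) (w n) k; (P n).map (X n k)] := fun n =>
    variance_sum_comp (hX n) (hindep n) (fun k => measurable_hajek _ (w n) k)
      ((hw n).memLp_hajek _)
  simp only [← hYvar] at hvar
  have hlog : (fun n : ℕ => (n * (2 + Real.log n)) ^ 2) =o[atTop]
      fun n => Var[∑ k, Y n k; P n] := (isBigO_mul_two_add_log.pow 2).trans_isLittleO hvar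
  refine asymptoticallyNormal_of_variance_sub_isLittleO (B := fun n => n * (2 + Real.log n))
    (fun n => memLp_rankSum_comp _ (hX n)) hYindep hYmem (fun n k => ae_of_all _ fun ω => ?_) ?_
    hlog (IsBigO.trans_isLittleO (IsBigO.of_bound (9 / 4) ?_) hlog)
  · simpa only [sub_zero] using abs_sub_integral_le_of_mem_Icc (hYmem n k).aestronglyMeasurable
      (fun ω => (hw n).hajek_mem_Icc _ k (X n k ω)) ω
  · filter_upwards [hvar.bound zero_lt_one, eventually_gt_atTop 1] with n hn hn1
    have hlog_pos : 0 < Real.log n := Real.log_pos (by exact_mod_cast hn1)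
    refine (variance_nonneg _ _).lt_of_ne' fun h0 => ?_
    rw [h0, norm_zero, mul_zero, norm_le_zero_iff] at hn
    exact (by positivity : ((n : ℝ) * Real.log n) ^ 2 ≠ 0) hn
  · refine Eventually.of_forall fun n => ?_
    rw [Real.norm_of_nonneg (variance_nonneg _ _), Real.norm_of_nonneg (sq_nonneg _)]
    refine (variance_rankSum_comp_sub_sum_hajek_le (w n) (hX n) (hindep n)).trans
      (mul_le_mul_of_nonneg_left ((hw n).sum_sq_le.trans ?_) (by norm_num))
    rw [mul_pow]
    gcongr
    nlinarith [Real.log_natCast_nonneg n]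

end RankSumCLT

section TailBounds

lemma eventually_one_le_log_natCast : ∀ᶠ n : ℕ in atTop, 1 ≤ Real.log n :=
  (Real.tendsto_log_atTop.comp tendsto_natCast_atTop_atTop).eventually_ge_atTop 1

lemma eventually_le_mul_of_isLittleO {q : ℕ → ℝ} (hq : ∀ᶠ n in atTop, 0 ≤ q n)
    (h : (fun n : ℕ => Real.log n ^ 2 / n) =o[atTop] q) {C : ℝ} (hC : 0 < C) :
    ∀ᶠ n : ℕ in atTop, C ≤ n * q n := by
  filter_upwards [hq, h.bound (inv_pos.2 hC), eventually_one_le_log_natCast,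
    eventually_gt_atTop 0] with n hqn hn hlog hn0
  have hn0' : (0 : ℝ) < n := by exact_mod_cast hn0
  rw [Real.norm_of_nonneg (by positivity), Real.norm_of_nonneg hqn, ← div_eq_inv_mul,
    div_le_div_iff₀ hn0' hC, mul_comm (q n)] at hn
  exact (le_mul_of_one_le_left hC.le (one_le_pow₀ hlog)).trans hn

lemma IndepLocationScale.le_sum_variance_hajek_of_tails {n : ℕ} {Ω : Type*} [MeasurableSpace Ω]
    {P : Measure Ω} [IsProbabilityMeasure P] {X : Fin n → Ω → ℝ} {μ σ : Fin n → ℝ}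
    (h : IndepLocationScale P X μ σ) {w : Fin n → ℝ} (hw : AdmissibleWeight w) (hn : 2 ≤ n)
    {t₀ M : ℝ} {lo up : ℝ → ℝ} (ht₀ : 0 ≤ t₀) (hlo : ∀ t, t₀ ≤ t → 0 < lo t)
    (hlow : ∀ j t, t₀ ≤ t → lo t ≤ survival P X μ σ j t)
    (hup : ∀ j t, t₀ ≤ t → survival P X μ σ j t ≤ up t)
    (hM : t₀ ≤ M) (hupM : 2 * up M ≤ lo (max (spread μ σ) t₀))
    (hnlo : 16 ≤ n * (lo (max (spread μ σ) t₀) ^ 3 * lo (spread μ σ + M * scaleRatio σ))) :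
    (t₀ * lo t₀) ^ 2 / 2048 * (n ^ 3 * (lo (max (spread μ σ) t₀) ^ 3
        * lo (spread μ σ + M * scaleRatio σ)))
      ≤ ∑ k, Var[hajek (fun i => P.map (X i)) w k; P.map (X k)] := by
  have hm : t₀ ≤ max (spread μ σ) t₀ := le_max_right _ _
  have hT : t₀ ≤ spread μ σ + M * scaleRatio σ :=
    hM.trans (le_spread_add_mul_scaleRatio hn μ h.sigma_pos (ht₀.trans hM))
  have hlo_le_one : ∀ t, t₀ ≤ t → lo t ≤ 1 := fun t ht =>
    (hlow ⟨0, by omega⟩ t ht).trans measureReal_le_one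
  have hlo_prod : lo (max (spread μ σ) t₀) ^ 3 * lo (spread μ σ + M * scaleRatio σ)
      ≤ lo (max (spread μ σ) t₀) :=
    (mul_le_of_le_one_right (pow_nonneg (hlo _ hm).le 3) (hlo_le_one _ hT)).trans
      (pow_le_of_le_one (hlo _ hm).le (hlo_le_one _ hm) three_ne_zero)
  have hnr : 8 ≤ n * (lo (max (spread μ σ) t₀) / 2) := by
    linarith [mul_le_mul_of_nonneg_left hlo_prod n.cast_nonneg]
  refine le_trans (le_of_eq ?_) (h.le_sum_variance_hajek hw ht₀ (hlo t₀ le_rfl).le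
    (half_pos (hlo _ hm)) (hlo _ hT).le (le_max_left _ t₀) (ht₀.trans hM) hnr
    (fun j => hlow j t₀ le_rfl) (fun j => ?_) (fun j => ?_) fun j => hlow j _ hT)
  · ring
  · linarith [hlow j _ hm]
  · linarith [hup j M hM]

variable {Ω : ℕ → Type*} [∀ n, MeasurableSpace (Ω n)] {P : ∀ n, Measure (Ω n)}
  {X : ∀ n, Fin n → Ω n → ℝ} {μ σ : ∀ n, Fin n → ℝ} {t₀ : ℝ} {lo up : ℝ → ℝ}

/-- The bounds of `TailBounds` on the laws of the `X j` alone, not on those of the differences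
`X j - X i`, and for large `n` only. -/
def MarginalTailBounds (P : ∀ n, Measure (Ω n)) (X : ∀ n, Fin n → Ω n → ℝ)
    (μ σ : ∀ n, Fin n → ℝ) (t₀ : ℝ) (lo up : ℝ → ℝ) : Prop :=
  ∀ᶠ n in atTop, ∀ j t, t₀ ≤ t → lo t ≤ survival (P n) (X n) (μ n) (σ n) j t ∧
    survival (P n) (X n) (μ n) (σ n) j t ≤ up t

lemma TailBounds.marginalTailBounds (h : TailBounds P X μ σ t₀ lo up) :
    MarginalTailBounds P X μ σ t₀ lo up := by
  filter_upwards [eventually_ge_atTop 2] with n hn j t ht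
  have := Fin.nontrivial_iff_two_le.2 hn
  obtain ⟨i, hij⟩ := exists_ne j
  exact (h n i j hij t ht).1

/-- `1 / (n (n - 1)) * ∑_{i ≠ j} w i 1(j < i) 1(x j > x i)`, the common form of `kendall`
(`w i = 1`) and `avgPrecision` (`w i = n / i`). -/
def weightedKendall {n : ℕ} (w x : Fin n → ℝ) : ℝ :=
  1 / ((n : ℝ) * ((n : ℝ) - 1)) * rankSum w x

variable [∀ n, IsProbabilityMeasure (P n)]

lemma asymptoticallyNormal_weightedKendall_of_tails {w : ∀ n, Fin n → ℝ}
    (hX : ∀ n, IndepLocationScale (P n) (X n) (μ n) (σ n)) (hw : ∀ n, AdmissibleWeight (w n))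
    (ht₀ : 0 < t₀) (hlo : ∀ t, t₀ ≤ t → 0 < lo t) (htail : MarginalTailBounds P X μ σ t₀ lo up)
    {M : ℕ → ℝ} (hM : ∀ n, t₀ ≤ M n)
    (hup : ∀ n, 2 * up (M n) ≤ lo (max (spread (μ n) (σ n)) t₀))
    (hrate : (fun n => (lo (max (spread (μ n) (σ n)) t₀) ^ 3
        * lo (spread (μ n) (σ n) + M n * scaleRatio (σ n)))⁻¹)
      =o[atTop] fun n : ℕ => n / Real.log n ^ 2) :
    AsymptoticallyNormal P fun n ω => weightedKendall (w n) fun i => X n i ω := by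
  set m := fun n => max (spread (μ n) (σ n)) t₀
  set T := fun n => spread (μ n) (σ n) + M n * scaleRatio (σ n)
  have hlo_pos : ∀ᶠ n in atTop, 0 < lo (m n) ^ 3 * lo (T n) := by
    filter_upwards [eventually_ge_atTop 2] with n hn
    exact mul_pos (pow_pos (hlo _ (le_max_right _ _)) 3) (hlo _ ((hM n).trans
      (le_spread_add_mul_scaleRatio hn _ (hX n).sigma_pos (ht₀.le.trans (hM n)))))
  have hrate_inv : (fun n : ℕ => Real.log n ^ 2 / n) =o[atTop]
      fun n => lo (m n) ^ 3 * lo (T n) := by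
    have := hrate.inv_rev (hlo_pos.mono fun n hn h0 => absurd h0 (inv_pos.2 hn).ne')
    simpa only [inv_inv, inv_div] using this
  have hlarge : ∀ᶠ n : ℕ in atTop, 16 ≤ n * (lo (m n) ^ 3 * lo (T n)) :=
    eventually_le_mul_of_isLittleO (hlo_pos.mono fun n => le_of_lt) hrate_inv (by norm_num)
  have hrow : (fun n : ℕ => (n : ℝ) ^ 3 * (lo (m n) ^ 3 * lo (T n))) =O[atTop] fun n =>
      ∑ k, Var[hajek (fun i => (P n).map (X n i)) (w n) k; (P n).map (X n k)] := by
    have hκ : 0 < (t₀ * lo t₀) ^ 2 / 2048 := by have := hlo t₀ le_rfl; positivity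
    refine IsBigO.of_bound ((t₀ * lo t₀) ^ 2 / 2048)⁻¹ ?_
    filter_upwards [hlarge, hlo_pos, htail, eventually_ge_atTop 2] with n hn16 hpos htailn hn
    rw [Real.norm_of_nonneg (by positivity), Real.norm_of_nonneg
      (Finset.sum_nonneg fun k _ => variance_nonneg _ _), ← div_eq_inv_mul, le_div_iff₀' hκ]
    exact (hX n).le_sum_variance_hajek_of_tails (hw n) hn ht₀.le hlo
      (fun j t ht => (htailn j t ht).1) (fun j t ht => (htailn j t ht).2) (hM n) (hup n) hn16
  refine (asymptoticallyNormal_rankSum_of_isLittleO (fun n => (hX n).measurable)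
    (fun n => (hX n).indep) hw ?_).const_mul
    (fun n => (memLp_rankSum_comp (w n) (hX n).measurable).aemeasurable) ?_
  · refine IsLittleO.trans_isBigO (((isBigO_refl (fun n : ℕ => (n : ℝ) ^ 3) atTop).mul_isLittleO
      hrate_inv).congr' ?_ .rfl) hrow
    filter_upwards [eventually_gt_atTop 0] with n hn
    field_simp
  · filter_upwards [eventually_gt_atTop 1] with n hn
    have : (1 : ℝ) < n := by exact_mod_cast hn
    have : 0 < (n : ℝ) - 1 := by linarith
    positivity

end TailBounds

section TailRates

lemma max_rpow_le_add_rpow {x y : ℝ} (hx : 0 ≤ x) (hy : 0 ≤ y) (p : ℝ) :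
    max x y ^ p ≤ x ^ p + y ^ p := by
  rcases max_choice x y with h | h <;> rw [h]
  · exact le_add_of_nonneg_right (by positivity)
  · exact le_add_of_nonneg_left (by positivity)

section Polynomial

variable {c₁ c₂ b₁ b₂ t₀ : ℝ}

lemma exists_polynomial_threshold (hc₁ : 0 < c₁) (hc₂ : 0 < c₂) (hb₂ : 0 < b₂) (hb : b₂ ≤ b₁)
    (ht₀ : 0 < t₀) :
    ∃ C > 0, ∀ m, t₀ ≤ m → m ≤ C * m ^ (b₁ / b₂) ∧
      2 * (c₂ * (C * m ^ (b₁ / b₂)) ^ (-b₂)) ≤ c₁ * m ^ (-b₁) := by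
  set A := (2 * c₂ / c₁) ^ (1 / b₂) with hA
  have hApos : 0 < A := by positivity
  have hApow : A ^ (-b₂) = c₁ / (2 * c₂) := by
    rw [hA, ← Real.rpow_mul (by positivity), one_div, inv_mul_eq_div, neg_div_self hb₂.ne',
      Real.rpow_neg_one, inv_div]
  refine ⟨max A (t₀ ^ (1 - b₁ / b₂)), lt_max_of_lt_left hApos, fun m hm => ?_⟩
  have hmpos : 0 < m := ht₀.trans_le hm
  constructor
  · have hpow : m ^ (1 - b₁ / b₂) ≤ t₀ ^ (1 - b₁ / b₂) :=
      Real.rpow_le_rpow_of_nonpos ht₀ hm (by linarith [(one_le_div hb₂).2 hb])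
    calc m = m ^ (1 - b₁ / b₂) * m ^ (b₁ / b₂) := by
          rw [← Real.rpow_add hmpos, sub_add_cancel, Real.rpow_one]
      _ ≤ max A (t₀ ^ (1 - b₁ / b₂)) * m ^ (b₁ / b₂) := by
          gcongr
          exact hpow.trans (le_max_right _ _)
  · have hpow : (max A (t₀ ^ (1 - b₁ / b₂)) * m ^ (b₁ / b₂)) ^ (-b₂)
        ≤ (A * m ^ (b₁ / b₂)) ^ (-b₂) := by
      refine Real.rpow_le_rpow_of_nonpos (by positivity) ?_ (by linarith)
      gcongr
      exact le_max_left _ _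
    calc 2 * (c₂ * (max A (t₀ ^ (1 - b₁ / b₂)) * m ^ (b₁ / b₂)) ^ (-b₂))
        ≤ 2 * (c₂ * (A * m ^ (b₁ / b₂)) ^ (-b₂)) := by gcongr
      _ = c₁ * m ^ (-b₁) := by
          rw [Real.mul_rpow hApos.le (by positivity), hApow, ← Real.rpow_mul hmpos.le, mul_neg,
            div_mul_cancel₀ _ hb₂.ne']
          field_simp

lemma inv_polynomial_tails_le (hc₁ : 0 < c₁) (hb₁ : 0 ≤ b₁) (hb₂ : b₂ ≠ 0) (ht₀ : 0 < t₀)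
    {R ρ C : ℝ} (hR : 0 ≤ R) (hρ : 1 ≤ ρ) (hC : 0 < C)
    (hCm : max R t₀ ≤ C * max R t₀ ^ (b₁ / b₂)) :
    ((c₁ * max R t₀ ^ (-b₁)) ^ 3 * (c₁ * (R + C * max R t₀ ^ (b₁ / b₂) * ρ) ^ (-b₁)))⁻¹
      ≤ (c₁ ^ 4)⁻¹ * (2 * C) ^ b₁ *
        (heavyRate b₁ b₂ R ρ + t₀ ^ ((3 * b₁ * b₂ + b₁ ^ 2) / b₂) * ρ ^ b₁) := by
  have hm_rpow := max_rpow_le_add_rpow hR ht₀.le ((3 * b₁ * b₂ + b₁ ^ 2) / b₂)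
  have hRm := le_max_left R t₀
  have hmpos : 0 < max R t₀ := lt_max_of_lt_right ht₀
  set m := max R t₀
  have hTle : R + C * m ^ (b₁ / b₂) * ρ ≤ 2 * C * m ^ (b₁ / b₂) * ρ := by
    linarith [le_mul_of_one_le_right (by positivity : 0 ≤ C * m ^ (b₁ / b₂)) hρ]
  have hexponent : (m ^ b₁) ^ 3 * (m ^ (b₁ / b₂)) ^ b₁
      = m ^ ((3 * b₁ * b₂ + b₁ ^ 2) / b₂) := by
    rw [← Real.rpow_natCast, ← Real.rpow_mul hmpos.le, ← Real.rpow_mul hmpos.le,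
      ← Real.rpow_add hmpos]
    congr 1
    push_cast
    field_simp
  have hTpos : 0 < R + C * m ^ (b₁ / b₂) * ρ := by positivity
  calc ((c₁ * m ^ (-b₁)) ^ 3 * (c₁ * (R + C * m ^ (b₁ / b₂) * ρ) ^ (-b₁)))⁻¹
      = (c₁ ^ 4)⁻¹ * ((m ^ b₁) ^ 3 * (R + C * m ^ (b₁ / b₂) * ρ) ^ b₁) := by
        rw [Real.rpow_neg hmpos.le, Real.rpow_neg hTpos.le]
        field_simp
    _ ≤ (c₁ ^ 4)⁻¹ * ((m ^ b₁) ^ 3 * (2 * C * m ^ (b₁ / b₂) * ρ) ^ b₁) := by gcongr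
    _ = (c₁ ^ 4)⁻¹ * (2 * C) ^ b₁ * (m ^ ((3 * b₁ * b₂ + b₁ ^ 2) / b₂) * ρ ^ b₁) := by
        rw [Real.mul_rpow (by positivity) (by positivity),
          Real.mul_rpow (by positivity) (by positivity), ← hexponent]
        ring
    _ ≤ (c₁ ^ 4)⁻¹ * (2 * C) ^ b₁ *
        (heavyRate b₁ b₂ R ρ + t₀ ^ ((3 * b₁ * b₂ + b₁ ^ 2) / b₂) * ρ ^ b₁) := by
        rw [heavyRate, ← add_mul]
        gcongr

end Polynomial

section Weibull

variable {c₁ c₂ b₁ b₂ t₀ l : ℝ}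

lemma xi_nonneg (p : ℝ) : 0 ≤ xi p := by
  unfold xi
  split_ifs <;> positivity

lemma add_rpow_le_xi_mul {x y p : ℝ} (hx : 0 ≤ x) (hy : 0 ≤ y) (hp : 0 ≤ p) :
    (x + y) ^ p ≤ xi p * (x ^ p + y ^ p) := by
  unfold xi
  split_ifs with h
  · rw [one_mul]
    exact Real.rpow_add_le_add_rpow hx hy hp h
  · exact_mod_cast NNReal.rpow_add_le_mul_rpow_add_rpow ⟨x, hx⟩ ⟨y, hy⟩ (not_le.1 h).le

lemma neg_mul_log_div_nonneg (hc₁ : 0 < c₁) (hc : c₁ ≤ 2 * c₂) (hb₂ : 0 ≤ b₂) :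
    0 ≤ -(1 / b₂) * Real.log (c₁ / (2 * c₂)) := by
  have hc₂ : 0 < 2 * c₂ := hc₁.trans_le hc
  exact mul_nonneg_of_nonpos_of_nonpos (neg_nonpos.2 (one_div_nonneg.2 hb₂))
    (Real.log_nonpos (by positivity) ((div_le_one hc₂).2 hc))

lemma le_K₃ (hD : 0 ≤ -(1 / b₂) * Real.log (c₁ / (2 * c₂))) (hb : 0 ≤ b₁ / b₂) (ht₀ : 0 ≤ t₀) :
    t₀ ≤ K₃ c₁ c₂ b₁ b₂ t₀ l := by
  rw [K₃, add_assoc]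
  refine le_add_of_nonneg_right (add_nonneg ?_ (mul_nonneg (xi_nonneg _) ?_)) <;> positivity

lemma K₄_nonneg (hb : 0 ≤ b₁ / b₂) : 0 ≤ K₄ b₁ b₂ l :=
  mul_nonneg (xi_nonneg _) (Real.rpow_nonneg hb _)

lemma add_mul_max_rpow_le (hD : 0 ≤ -(1 / b₂) * Real.log (c₁ / (2 * c₂))) (hb : 0 ≤ b₁ / b₂)
    (ht₀ : 0 ≤ t₀) (hl : 0 < l) {R : ℝ} (hR : 0 ≤ R) :
    -(1 / b₂) * Real.log (c₁ / (2 * c₂)) + b₁ / b₂ * max R t₀ ^ l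
      ≤ (K₃ c₁ c₂ b₁ b₂ t₀ l + K₄ b₁ b₂ l * R) ^ l := by
  rw [K₃, K₄]
  set D := -(1 / b₂) * Real.log (c₁ / (2 * c₂))
  have := xi_nonneg (1 / l)
  have hlarge : (D + b₁ / b₂ * R ^ l) ^ (1 / l)
      ≤ xi (1 / l) * D ^ (1 / l) + xi (1 / l) * (b₁ / b₂) ^ (1 / l) * R := by
    refine (add_rpow_le_xi_mul hD (by positivity) (by positivity)).trans (le_of_eq ?_)
    rw [Real.mul_rpow hb (by positivity), ← Real.rpow_mul hR, mul_one_div_cancel hl.ne',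
      Real.rpow_one]
    ring
  have hroot : (D + b₁ / b₂ * max R t₀ ^ l) ^ (1 / l)
      ≤ t₀ + (D + b₁ / b₂ * t₀ ^ l) ^ (1 / l) + xi (1 / l) * D ^ (1 / l)
        + xi (1 / l) * (b₁ / b₂) ^ (1 / l) * R := by
    have hsmall_nonneg : 0 ≤ (D + b₁ / b₂ * t₀ ^ l) ^ (1 / l) := by positivity
    have hlarge_nonneg : 0 ≤ (D + b₁ / b₂ * R ^ l) ^ (1 / l) := by positivity
    rcases max_choice R t₀ with h | h <;> rw [h] <;> linarith
  calc D + b₁ / b₂ * max R t₀ ^ l = ((D + b₁ / b₂ * max R t₀ ^ l) ^ (1 / l)) ^ l := by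
        rw [← Real.rpow_mul (by positivity), one_div_mul_cancel hl.ne', Real.rpow_one]
    _ ≤ _ := by gcongr

lemma two_mul_weibull_tail_le (hc₁ : 0 < c₁) (hc : c₁ ≤ 2 * c₂) (hb₂ : 0 < b₂) (hb₁ : 0 ≤ b₁)
    (ht₀ : 0 ≤ t₀) (hl : 0 < l) {R : ℝ} (hR : 0 ≤ R) :
    2 * (c₂ * Real.exp (-b₂ * (K₃ c₁ c₂ b₁ b₂ t₀ l + K₄ b₁ b₂ l * R) ^ l))
      ≤ c₁ * Real.exp (-b₁ * max R t₀ ^ l) := by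
  have hc₂ : 0 < c₂ := by linarith
  have hpow := mul_le_mul_of_nonneg_left (add_mul_max_rpow_le
    (neg_mul_log_div_nonneg hc₁ hc hb₂.le) (div_nonneg hb₁ hb₂.le) ht₀ hl hR) hb₂.le
  have hsplit : b₂ * (-(1 / b₂) * Real.log (c₁ / (2 * c₂)) + b₁ / b₂ * max R t₀ ^ l)
      = -Real.log (c₁ / (2 * c₂)) + b₁ * max R t₀ ^ l := by field_simp
  rw [hsplit] at hpow
  calc 2 * (c₂ * Real.exp (-b₂ * (K₃ c₁ c₂ b₁ b₂ t₀ l + K₄ b₁ b₂ l * R) ^ l))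
      ≤ 2 * (c₂ * Real.exp (Real.log (c₁ / (2 * c₂)) + -b₁ * max R t₀ ^ l)) := by
        gcongr
        linarith
    _ = c₁ * Real.exp (-b₁ * max R t₀ ^ l) := by
        rw [Real.exp_add, Real.exp_log (by positivity)]
        field_simp

lemma inv_weibull_tails_le (hc₁ : 0 < c₁) (hb₁ : 0 ≤ b₁) (ht₀ : 0 ≤ t₀) {R : ℝ} (hR : 0 ≤ R)
    (ρ : ℝ) :
    ((c₁ * Real.exp (-b₁ * max R t₀ ^ l)) ^ 3 * (c₁ * Real.exp (-b₁ *
        (R + (K₃ c₁ c₂ b₁ b₂ t₀ l + K₄ b₁ b₂ l * R) * ρ) ^ l)))⁻¹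
      ≤ (c₁ ^ 4)⁻¹ * Real.exp (3 * b₁ * t₀ ^ l) *
        Real.exp (lightRate c₁ c₂ b₁ b₂ t₀ l R ρ) := by
  have harg : R + (K₃ c₁ c₂ b₁ b₂ t₀ l + K₄ b₁ b₂ l * R) * ρ
      = R + K₃ c₁ c₂ b₁ b₂ t₀ l * ρ + K₄ b₁ b₂ l * ρ * R := by ring
  have hmax := mul_le_mul_of_nonneg_left (max_rpow_le_add_rpow hR ht₀ l) hb₁
  rw [mul_pow, mul_mul_mul_comm, ← pow_succ, mul_inv, ← Real.exp_nat_mul, ← Real.exp_add,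
    ← Real.exp_neg, mul_assoc, ← Real.exp_add, lightRate, harg]
  gcongr
  push_cast
  linarith

end Weibull

end TailRates

section RankStatistics

variable {Ω : ℕ → Type*} [∀ n, MeasurableSpace (Ω n)] {P : ∀ n, Measure (Ω n)}
  [∀ n, IsProbabilityMeasure (P n)] {X : ∀ n, Fin n → Ω n → ℝ} {μ σ : ∀ n, Fin n → ℝ}
  {w : ∀ n, Fin n → ℝ} {c₁ c₂ b₁ b₂ t₀ l : ℝ}

lemma asymptoticallyNormal_weightedKendall_of_polynomialTails
    (hX : ∀ n, IndepLocationScale (P n) (X n) (μ n) (σ n)) (hw : ∀ n, AdmissibleWeight (w n))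
    (hc₁ : 0 < c₁) (hc₂ : 0 < c₂) (hb₂ : 0 < b₂) (hb : b₂ ≤ b₁) (ht₀ : 0 < t₀)
    (htail : MarginalTailBounds P X μ σ t₀ (fun t => c₁ * t ^ (-b₁)) fun t => c₂ * t ^ (-b₂))
    (hheavy : (fun n => heavyRate b₁ b₂ (spread (μ n) (σ n)) (scaleRatio (σ n)))
      =o[atTop] fun n : ℕ => n / Real.log n ^ 2)
    (hratio : (fun n => scaleRatio (σ n) ^ b₁) =o[atTop] fun n : ℕ => n / Real.log n ^ 2) :
    AsymptoticallyNormal P fun n ω => weightedKendall (w n) fun i => X n i ω := by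
  obtain ⟨C, hC, hthreshold⟩ := exists_polynomial_threshold hc₁ hc₂ hb₂ hb ht₀
  have hm : ∀ n, t₀ ≤ max (spread (μ n) (σ n)) t₀ := fun n => le_max_right _ _
  refine asymptoticallyNormal_weightedKendall_of_tails hX hw ht₀ (fun t ht => ?_) htail
    (M := fun n => C * max (spread (μ n) (σ n)) t₀ ^ (b₁ / b₂))
    (fun n => (hm n).trans (hthreshold _ (hm n)).1) (fun n => (hthreshold _ (hm n)).2) ?_
  · have := ht₀.trans_le ht
    positivity
  · refine IsBigO.trans_isLittleO (IsBigO.of_bound ((c₁ ^ 4)⁻¹ * (2 * C) ^ b₁) ?_)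
      (hheavy.add (hratio.const_mul_left (t₀ ^ ((3 * b₁ * b₂ + b₁ ^ 2) / b₂))))
    filter_upwards [eventually_ge_atTop 2] with n hn
    have hR := spread_nonneg (μ n) (σ n)
    have hρ := one_le_scaleRatio hn (hX n).sigma_pos
    rw [Real.norm_of_nonneg (by positivity), Real.norm_of_nonneg (by rw [heavyRate]; positivity)]
    exact inv_polynomial_tails_le hc₁ (hb₂.le.trans hb) hb₂.ne' ht₀ hR hρ hC
      (hthreshold _ (hm n)).1

lemma asymptoticallyNormal_weightedKendall_of_weibullTails
    (hX : ∀ n, IndepLocationScale (P n) (X n) (μ n) (σ n)) (hw : ∀ n, AdmissibleWeight (w n))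
    (hc₁ : 0 < c₁) (hc : c₁ ≤ 2 * c₂) (hb₂ : 0 < b₂) (hb₁ : 0 ≤ b₁) (ht₀ : 0 < t₀) (hl : 0 < l)
    (htail : MarginalTailBounds P X μ σ t₀ (fun t => c₁ * Real.exp (-b₁ * t ^ l))
      fun t => c₂ * Real.exp (-b₂ * t ^ l))
    (hlight : (fun n => Real.exp (lightRate c₁ c₂ b₁ b₂ t₀ l (spread (μ n) (σ n))
      (scaleRatio (σ n)))) =o[atTop] fun n : ℕ => n / Real.log n ^ 2) :
    AsymptoticallyNormal P fun n ω => weightedKendall (w n) fun i => X n i ω := by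
  have hb : 0 ≤ b₁ / b₂ := div_nonneg hb₁ hb₂.le
  have hK₃ : t₀ ≤ K₃ c₁ c₂ b₁ b₂ t₀ l := le_K₃ (neg_mul_log_div_nonneg hc₁ hc hb₂.le) hb ht₀.le
  refine asymptoticallyNormal_weightedKendall_of_tails hX hw ht₀ (fun t _ => by positivity) htail
    (M := fun n => K₃ c₁ c₂ b₁ b₂ t₀ l + K₄ b₁ b₂ l * spread (μ n) (σ n))
    (fun n => hK₃.trans (le_add_of_nonneg_right
      (mul_nonneg (K₄_nonneg hb) (spread_nonneg _ _))))
    (fun n => two_mul_weibull_tail_le hc₁ hc hb₂ hb₁ ht₀.le hl (spread_nonneg _ _)) ?_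
  refine IsBigO.trans_isLittleO (IsBigO.of_bound ((c₁ ^ 4)⁻¹ * Real.exp (3 * b₁ * t₀ ^ l)) ?_)
    hlight
  refine Eventually.of_forall fun n => ?_
  rw [Real.norm_of_nonneg (by positivity), Real.norm_of_nonneg (Real.exp_pos _).le]
  exact inv_weibull_tails_le hc₁ hb₁ ht₀.le (spread_nonneg _ _) _

end RankStatistics

section Rates

lemma rpow_third_isLittleO :
    (fun n : ℕ => (n : ℝ) ^ (1 / 3 : ℝ)) =o[atTop] fun n : ℕ => n / Real.log n ^ 2 := by
  have hlog : (fun x : ℝ => Real.log x ^ 2) =o[atTop] fun x => (x ^ (1 / 3 : ℝ)) ^ 2 :=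
    (isLittleO_log_rpow_atTop (by norm_num)).pow two_pos
  have hinv := hlog.inv_rev <| (eventually_gt_atTop 1).mono fun x hx h =>
    absurd h (pow_pos (Real.log_pos hx) 2).ne'
  refine (((isBigO_refl (fun x : ℝ => x) atTop).mul_isLittleO hinv).comp_tendsto
    tendsto_natCast_atTop_atTop).congr' ?_ (Eventually.of_forall fun n => (div_eq_mul_inv _ _).symm)
  filter_upwards [eventually_gt_atTop 0] with n hn
  have hn' : (0 : ℝ) < n := Nat.cast_pos.2 hn
  change (n : ℝ) * (((n : ℝ) ^ (1 / 3 : ℝ)) ^ 2)⁻¹ = n ^ (1 / 3 : ℝ)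
  nth_rw 1 [← Real.rpow_one (n : ℝ)]
  rw [← Real.rpow_natCast, ← Real.rpow_mul hn'.le, ← Real.rpow_neg hn'.le, ← Real.rpow_add hn']
  norm_num

lemma rpow_third_mul_log_isLittleO :
    (fun n : ℕ => (n : ℝ) ^ (1 / 3 : ℝ) * Real.log n ^ (-2 : ℝ))
      =o[atTop] fun n : ℕ => n / Real.log n ^ 2 := by
  refine IsBigO.trans_isLittleO (IsBigO.of_bound 1 ?_) rpow_third_isLittleO
  filter_upwards [eventually_one_le_log_natCast] with n hn
  rw [one_mul, norm_mul, Real.norm_of_nonneg (by positivity : 0 ≤ Real.log n ^ (-2 : ℝ))]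
  exact mul_le_of_le_one_right (norm_nonneg _)
    (Real.rpow_le_one_of_one_le_of_nonpos hn (by norm_num))

lemma exp_third_mul_log_eventuallyEq :
    (fun n : ℕ => Real.exp (1 / 3 * Real.log n)) =ᶠ[atTop] fun n => (n : ℝ) ^ (1 / 3 : ℝ) := by
  filter_upwards [eventually_gt_atTop 0] with n hn
  rw [Real.rpow_def_of_pos (by exact_mod_cast hn), mul_comm]

lemma exp_third_mul_log_sub_eventuallyEq :
    (fun n : ℕ => Real.exp (1 / 3 * Real.log n - 2 * Real.log (Real.log n)))
      =ᶠ[atTop] fun n => (n : ℝ) ^ (1 / 3 : ℝ) * Real.log n ^ (-2 : ℝ) := by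
  filter_upwards [eventually_gt_atTop 0, eventually_one_le_log_natCast] with n hn hlog
  rw [Real.rpow_def_of_pos (by exact_mod_cast hn), Real.rpow_def_of_pos (by linarith),
    ← Real.exp_add]
  ring_nf

end Rates

end RankCLT

end

theorem mainTheorem7_general {Ω : ℕ → Type*} [∀ n, MeasurableSpace (Ω n)]
    (P : ∀ n, Measure (Ω n)) [∀ n, IsProbabilityMeasure (P n)]
    (X : ∀ n, Fin n → Ω n → ℝ) (μ σ w : ∀ n, Fin n → ℝ)
    (hX : ∀ n, RankCLT.IndepLocationScale (P n) (X n) (μ n) (σ n))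
    (hw : ∀ n, RankCLT.AdmissibleWeight (w n)) :
    (∀ c₁ c₂ b₁ b₂ t₀ : ℝ, 0 < c₁ → 0 < c₂ → 0 < b₂ → b₂ ≤ b₁ → 0 < t₀ →
      RankCLT.MarginalTailBounds P X μ σ t₀ (fun t => c₁ * t ^ (-b₁)) (fun t => c₂ * t ^ (-b₂)) →
      (fun n => RankCLT.heavyRate b₁ b₂ (RankCLT.spread (μ n) (σ n)) (RankCLT.scaleRatio (σ n)))
        =o[atTop] (fun n : ℕ => n / Real.log n ^ 2) →
      (fun n => RankCLT.scaleRatio (σ n) ^ b₁) =o[atTop] (fun n : ℕ => n / Real.log n ^ 2) →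
      RankCLT.AsymptoticallyNormal P fun n ω => RankCLT.weightedKendall (w n) fun i => X n i ω) ∧
    (∀ c₁ c₂ b₁ b₂ t₀ l : ℝ, 0 < c₁ → c₁ ≤ 2 * c₂ → 0 < b₂ → 0 ≤ b₁ → 0 < t₀ → 0 < l →
      RankCLT.MarginalTailBounds P X μ σ t₀ (fun t => c₁ * Real.exp (-b₁ * t ^ l))
        (fun t => c₂ * Real.exp (-b₂ * t ^ l)) →
      (fun n => Real.exp (RankCLT.lightRate c₁ c₂ b₁ b₂ t₀ l
        (RankCLT.spread (μ n) (σ n)) (RankCLT.scaleRatio (σ n))))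
        =o[atTop] (fun n : ℕ => n / Real.log n ^ 2) →
      RankCLT.AsymptoticallyNormal P fun n ω => RankCLT.weightedKendall (w n) fun i => X n i ω) :=
  ⟨fun _ _ _ _ _ => RankCLT.asymptoticallyNormal_weightedKendall_of_polynomialTails hX hw,
    fun _ _ _ _ _ _ => RankCLT.asymptoticallyNormal_weightedKendall_of_weibullTails hX hw⟩

theorem mainTheorem7 {Ω : ℕ → Type*} [∀ n, MeasurableSpace (Ω n)]
    (P : ∀ n, Measure (Ω n)) [∀ n, IsProbabilityMeasure (P n)]
    (X : ∀ n, Fin n → Ω n → ℝ) (μ σ : ∀ n, Fin n → ℝ)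
    (hX : ∀ n, RankCLT.LocationScale (P n) (X n) (μ n) (σ n)) :
    -- polynomial tails
    (∀ c₁ c₂ b₁ b₂ t₀ : ℝ, 0 < c₁ → 0 < c₂ → 0 < b₂ → b₂ < b₁ → 0 < t₀ →
      RankCLT.TailBounds P X μ σ t₀ (fun t => c₁ * t ^ (-b₁)) (fun t => c₂ * t ^ (-b₂)) →
      ((RankCLT.StrictlyLesssim
            (fun n => RankCLT.heavyRate b₁ b₂ (RankCLT.spread (μ n) (σ n))
              (RankCLT.scaleRatio (σ n)))
            (fun n => (n : ℝ) ^ (1 / 3 : ℝ)) →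
          (fun n => RankCLT.scaleRatio (σ n) ^ b₁) =O[atTop]
            (fun n : ℕ => (n : ℝ) ^ (1 / 3 : ℝ)) →
          RankCLT.AsymptoticallyNormal P (fun n ω => RankCLT.kendall (fun i => X n i ω))) ∧
        (RankCLT.StrictlyLesssim
            (fun n => RankCLT.heavyRate b₁ b₂ (RankCLT.spread (μ n) (σ n))
              (RankCLT.scaleRatio (σ n)))
            (fun n => (n : ℝ) ^ (1 / 3 : ℝ) * Real.log n ^ (-2 : ℝ)) →
          (fun n => RankCLT.scaleRatio (σ n) ^ b₁) =O[atTop]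
            (fun n : ℕ => (n : ℝ) ^ (1 / 3 : ℝ) * Real.log n ^ (-2 : ℝ)) →
          RankCLT.AsymptoticallyNormal P
            (fun n ω => RankCLT.avgPrecision (fun i => X n i ω))))) ∧
    -- Weibull-type tails
    (∀ c₁ c₂ b₁ b₂ t₀ l : ℝ, 0 < c₁ → 0 < c₂ → c₁ ≤ 2 * c₂ → 0 < b₂ → b₂ < b₁ → 0 < t₀ →
      0 < l →
      RankCLT.TailBounds P X μ σ t₀ (fun t => c₁ * Real.exp (-b₁ * t ^ l))
        (fun t => c₂ * Real.exp (-b₂ * t ^ l)) →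
      ((RankCLT.StrictlyLesssim
            (fun n => Real.exp (RankCLT.lightRate c₁ c₂ b₁ b₂ t₀ l
              (RankCLT.spread (μ n) (σ n)) (RankCLT.scaleRatio (σ n))))
            (fun n => Real.exp (1 / 3 * Real.log n)) →
          RankCLT.AsymptoticallyNormal P (fun n ω => RankCLT.kendall (fun i => X n i ω))) ∧
        (RankCLT.StrictlyLesssim
            (fun n => Real.exp (RankCLT.lightRate c₁ c₂ b₁ b₂ t₀ l
              (RankCLT.spread (μ n) (σ n)) (RankCLT.scaleRatio (σ n))))
            (fun n => Real.exp (1 / 3 * Real.log n - 2 * Real.log (Real.log n))) →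
          RankCLT.AsymptoticallyNormal P
            (fun n ω => RankCLT.avgPrecision (fun i => X n i ω))))) := by
  have hX' n := (hX n).indepLocationScale
  have hken := mainTheorem7_general P X μ σ _ hX' fun _ => RankCLT.admissibleWeight_one
  have hap := mainTheorem7_general P X μ σ _ hX' fun _ => RankCLT.admissibleWeight_div
  have hrateKen := RankCLT.rpow_third_isLittleO
  have hrateAP := RankCLT.rpow_third_mul_log_isLittleO
  refine ⟨fun c₁ c₂ b₁ b₂ t₀ hc₁ hc₂ hb₂ hb ht₀ hT => ⟨fun hheavy hratio => ?_,
    fun hheavy hratio => ?_⟩, fun c₁ c₂ b₁ b₂ t₀ l hc₁ _ hc hb₂ hb ht₀ hl hT =>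
    ⟨fun hlight => ?_, fun hlight => ?_⟩⟩
  · exact hken.1 c₁ c₂ b₁ b₂ t₀ hc₁ hc₂ hb₂ hb.le ht₀ hT.marginalTailBounds
      (hheavy.1.trans_isLittleO hrateKen) (hratio.trans_isLittleO hrateKen)
  · exact hap.1 c₁ c₂ b₁ b₂ t₀ hc₁ hc₂ hb₂ hb.le ht₀ hT.marginalTailBounds
      (hheavy.1.trans_isLittleO hrateAP) (hratio.trans_isLittleO hrateAP)
  · exact hken.2 c₁ c₂ b₁ b₂ t₀ l hc₁ hc hb₂ (hb₂.le.trans hb.le) ht₀ hl hT.marginalTailBounds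
      (hlight.1.trans_isLittleO
        (RankCLT.exp_third_mul_log_eventuallyEq.trans_isLittleO hrateKen))
  · exact hap.2 c₁ c₂ b₁ b₂ t₀ l hc₁ hc hb₂ (hb₂.le.trans hb.le) ht₀ hl hT.marginalTailBounds
      (hlight.1.trans_isLittleO
        (RankCLT.exp_third_mul_log_sub_eventuallyEq.trans_isLittleO hrateAP))
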